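/- Let $\mathbb{S}^2$ be the unit sphere of $\mathbb{R}^3$. For $\mathcal{H}\in C^1(\mathbb{S}^2)$, a closed $\mathcal{H}$-surface is a non-empty compact surface $M$ without boundary, immersed in $\mathbb{R}^3$ by a $C^2$ immersion and oriented by a unit normal field (Gauss map) $N:M\to\mathbb{S}^2$, whose mean curvature $H_M=\tfrac12\operatorname{trace}(-dN)$ satisfies $H_M(p)=\mathcal{H}(N_p)$ for all $p\in M$. Let $\mathcal{H}=h_0+\lambda$, where $\lambda\in\mathbb{R}$ and $h_0\in C^1(\mathbb{S}^2)$ is not identically zero. If there is $v\in\mathbb{S}^2$ such that $h_0(x)\langle x,v\rangle\ge 0$ for all $x\in\mathbb{S}^2$, then there is no closed $\mathcal{H}$-surface. In particular, for every $v\in\mathbb{S}^2$, every odd natural number $n$ and every $\lambda>1$, the function $\mathcal{H}(x)=\langle x,v\rangle^n+\lambda$ on $\mathbb{S}^2$ is of class $C^1$ and positive, and there is no closed $\mathcal{H}$-surface. -/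

import Mathlib

open scoped Manifold ContDiff InnerProductSpace

universe u

/-- Euclidean three-space. -/
abbrev E3 : Type := EuclideanSpace ℝ (Fin 3)

/-- The unit sphere of Euclidean three-space, with Mathlib's manifold structure. -/
abbrev S2 : Type := Metric.sphere (0 : E3) 1

instance instFactFinrankE3 : Fact (Module.finrank ℝ E3 = 2 + 1) :=
  ⟨by simp⟩

section Surfaces

variable {M : Type*} [TopologicalSpace M] [ChartedSpace (EuclideanSpace ℝ (Fin 2)) M]

/-- The `i`-th vector of the standard basis of the model plane, seen as a tangent vector
of `M` at `p` (a coordinate vector of the preferred chart at `p`). -/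
noncomputable def coordVec (p : M) (i : Fin 2) : TangentSpace (𝓡 2) p :=
  (EuclideanSpace.single i (1 : ℝ) : EuclideanSpace ℝ (Fin 2))

/-- The differential `T_p M → ℝ³` of a map `f : M → ℝ³`. -/
noncomputable def diffAt (f : M → E3) (p : M) : TangentSpace (𝓡 2) p →L[ℝ] E3 :=
  mfderiv (𝓡 2) 𝓘(ℝ, E3) f p

/-- Gram matrix of the first fundamental form `I(a, b) = ⟨dψ a, dψ b⟩` at `p`. -/
noncomputable def firstForm (ψ : M → E3) (p : M) : Matrix (Fin 2) (Fin 2) ℝ :=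
  Matrix.of fun i j => ⟪diffAt ψ p (coordVec p i), diffAt ψ p (coordVec p j)⟫_ℝ

/-- Matrix of the second fundamental form `II(a, b) = -⟨dN a, dψ b⟩` at `p`, with respect
to the unit normal field `N`. -/
noncomputable def secondForm (ψ : M → E3) (N : M → S2) (p : M) : Matrix (Fin 2) (Fin 2) ℝ :=
  Matrix.of fun i j =>
    -⟪diffAt (fun q => (N q : E3)) p (coordVec p i), diffAt ψ p (coordVec p j)⟫_ℝ

/-- The mean curvature `H = (1/2) trace (I⁻¹ II)`, half the trace of the shape operator
`-dN` (so the unit sphere with its inner normal has mean curvature `1`). The value does not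
depend on the basis of `T_p M` in which the two forms are written. -/
noncomputable def meanCurvature (ψ : M → E3) (N : M → S2) (p : M) : ℝ :=
  (1 / 2) * ((firstForm ψ p)⁻¹ * secondForm ψ N p).trace

/-- `ψ : M → ℝ³` is an immersion of class `C²`, oriented by the unit normal field (Gauss
map) `N`. Embeddedness is not required. The Gauss map of a `C²` immersion is
of class `C¹` as soon as it is continuous. -/
structure IsOrientedImmersion (ψ : M → E3) (N : M → S2) : Prop where
  contMDiff : ContMDiff (𝓡 2) 𝓘(ℝ, E3) 2 ψ
  injective : ∀ p, Function.Injective (diffAt ψ p)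
  contMDiff_gauss : ContMDiff (𝓡 2) 𝓘(ℝ, E3) 1 (fun p => (N p : E3))
  normal : ∀ (p : M) (w : TangentSpace (𝓡 2) p), ⟪diffAt ψ p w, (N p : E3)⟫_ℝ = 0

/-- The surface immersed by `ψ` and oriented by `N` is an `𝓗`-surface: its mean curvature
at every point `p` is `𝓗 (N p)`. -/
structure IsHSurface (𝓗 : S2 → ℝ) (ψ : M → E3) (N : M → S2) : Prop
    extends IsOrientedImmersion ψ N where
  meanCurvature_eq : ∀ p, meanCurvature ψ N p = 𝓗 (N p)

end Surfaces

/-- There is no closed `𝓗`-surface: no nonempty compact surface without boundary admits an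
oriented immersion into `ℝ³` that makes it an `𝓗`-surface. (Manifolds modelled on
the plane `EuclideanSpace ℝ (Fin 2)` have no boundary. Connectedness is not required, so
connected surfaces are covered in particular.) -/
def NoClosedHSurface (𝓗 : S2 → ℝ) : Prop :=
  ∀ (M : Type u) [TopologicalSpace M] [T2Space M] [CompactSpace M] [Nonempty M]
    [ChartedSpace (EuclideanSpace ℝ (Fin 2)) M] [IsManifold (𝓡 2) ∞ M]
    (ψ : M → E3) (N : M → S2), ¬ IsHSurface 𝓗 ψ N

/-! The engine is a flux formula. On a closed surface the one-form `ω = (1/2) det(v, N, dψ) +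
(lam/2) det(v, ψ, dψ)` satisfies `dω = (lam - H) ⟨N, v⟩ dA`, so `∫ (H - lam) ⟨N, v⟩ dA = 0`. If `H =
h₀ ∘ N + lam`, the integrand is `h₀(N) ⟨N, v⟩ ≥ 0`, hence it vanishes at every point
(`flux_eq_zero_of_nonneg`). Off the equator `⟨x, v⟩ = 0` this gives `h₀(N) = 0`; on the equator `h₀`
vanishes anyway, because it changes sign there (`eq_zero_of_mul_inner_nonneg`). So the surface has
constant mean curvature `lam`. Comparison with a sphere gives `lam ≠ 0`, and comparison with planes
then shows that the Gauss map is onto (`surjective_gauss_of_const`). Thus `h₀` vanishes identically,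
a contradiction.

Stokes' theorem is proved by hand. In a chart it reduces to the symmetry of second derivatives
(`fderiv_fluxCoeff_sub`) and to the vanishing integral of a derivative with compact support. Charts
need not respect the orientation given by `N`, so area is measured by `|density|` and the partition
of unity is subordinate to regions where `density` keeps its sign. A double sum over the partition
replaces a globally defined integral. -/

/-! ### Triple products and the algebra of the shape operator -/

/-- The triple product of three vectors of Euclidean space, linear in the last two. -/
noncomputable def triple (n : E3) : E3 →L[ℝ] E3 →L[ℝ] ℝ :=
  LinearMap.toContinuousBilinearMap <| LinearMap.mk₂ ℝ
    (fun X Y : E3 => n 0 * (X 1 * Y 2 - X 2 * Y 1) + n 1 * (X 2 * Y 0 - X 0 * Y 2)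
      + n 2 * (X 0 * Y 1 - X 1 * Y 0))
    (fun _ _ _ => by simp only [PiLp.add_apply]; ring)
    (fun _ _ _ => by simp only [PiLp.smul_apply, smul_eq_mul]; ring)
    (fun _ _ _ => by simp only [PiLp.add_apply]; ring)
    (fun _ _ _ => by simp only [PiLp.smul_apply, smul_eq_mul]; ring)

theorem triple_apply (n X Y : E3) :
    triple n X Y = n 0 * (X 1 * Y 2 - X 2 * Y 1) + n 1 * (X 2 * Y 0 - X 0 * Y 2)
      + n 2 * (X 0 * Y 1 - X 1 * Y 0) := rfl

theorem triple_swap (n X Y : E3) : triple n X Y = -triple n Y X := by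
  simp only [triple_apply]; ring

theorem triple_self (n X : E3) : triple n X X = 0 := by
  simp only [triple_apply]; ring

theorem inner_E3 (X Y : E3) : ⟪X, Y⟫_ℝ = X 0 * Y 0 + X 1 * Y 1 + X 2 * Y 2 := by
  simp [PiLp.inner_apply, Fin.sum_univ_three, mul_comm]

/-- The product of two triple products is a Gram determinant. -/
theorem triple_mul_triple (a b c d e f : E3) :
    triple a b c * triple d e f =
      ⟪a, d⟫_ℝ * (⟪b, e⟫_ℝ * ⟪c, f⟫_ℝ - ⟪b, f⟫_ℝ * ⟪c, e⟫_ℝ)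
      - ⟪a, e⟫_ℝ * (⟪b, d⟫_ℝ * ⟪c, f⟫_ℝ - ⟪b, f⟫_ℝ * ⟪c, d⟫_ℝ)
      + ⟪a, f⟫_ℝ * (⟪b, d⟫_ℝ * ⟪c, e⟫_ℝ - ⟪b, e⟫_ℝ * ⟪c, d⟫_ℝ) := by
  simp only [triple_apply, inner_E3]; ring

/-- The cross product of two vectors orthogonal to the unit vector `n` is a multiple of `n`. -/
theorem triple_of_orthogonal {n X Y : E3} (v : E3) (hn : ⟪n, n⟫_ℝ = 1) (hX : ⟪X, n⟫_ℝ = 0)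
    (hY : ⟪Y, n⟫_ℝ = 0) : triple v X Y = triple n X Y * ⟪n, v⟫_ℝ := by
  simp only [triple_apply, inner_E3] at *
  linear_combination
    -(v 0 * (X 1 * Y 2 - X 2 * Y 1) + v 1 * (X 2 * Y 0 - X 0 * Y 2)
      + v 2 * (X 0 * Y 1 - X 1 * Y 0)) * hn
    + (X 0 * (n 1 * v 2 - n 2 * v 1) + X 1 * (n 2 * v 0 - n 0 * v 2)
      + X 2 * (n 0 * v 1 - n 1 * v 0)) * hY
    - (Y 0 * (n 1 * v 2 - n 2 * v 1) + Y 1 * (n 2 * v 0 - n 0 * v 2)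
      + Y 2 * (n 0 * v 1 - n 1 * v 0)) * hX

theorem triple_sq_of_orthogonal {n X Y : E3} (hn : ⟪n, n⟫_ℝ = 1) (hX : ⟪X, n⟫_ℝ = 0)
    (hY : ⟪Y, n⟫_ℝ = 0) :
    triple n X Y * triple n X Y = ⟪X, X⟫_ℝ * ⟪Y, Y⟫_ℝ - ⟪X, Y⟫_ℝ * ⟪Y, X⟫_ℝ := by
  rw [triple_mul_triple, hn, real_inner_comm, hX]
  rw [real_inner_comm, hY] 
  ring

/-- Strict Cauchy–Schwarz: `|X|²` times the Gram determinant is the squared norm of `Z = |X|² Y -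
⟨X, Y⟩ X`, which is nonzero by independence. -/
theorem gram_pos {X Y : E3} (h : LinearIndependent ℝ ![X, Y]) :
    0 < ⟪X, X⟫_ℝ * ⟪Y, Y⟫_ℝ - ⟪X, Y⟫_ℝ * ⟪Y, X⟫_ℝ := by
  have hX : X ≠ 0 := h.ne_zero 0
  have hXX : 0 < ⟪X, X⟫_ℝ := real_inner_self_pos.2 hX
  set Z : E3 := ⟪X, X⟫_ℝ • Y - ⟪X, Y⟫_ℝ • X with hZ
  have hZ0 : Z ≠ 0 := by
    intro h0
    have := (LinearIndependent.pair_iff.1 h) (-⟪X, Y⟫_ℝ) ⟪X, X⟫_ℝ (by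
      rw [← h0, hZ, neg_smul]; abel)
    exact hXX.ne' this.2
  have hZZ : 0 < ⟪Z, Z⟫_ℝ := real_inner_self_pos.2 hZ0
  have : ⟪Z, Z⟫_ℝ = ⟪X, X⟫_ℝ * (⟪X, X⟫_ℝ * ⟪Y, Y⟫_ℝ - ⟪X, Y⟫_ℝ * ⟪Y, X⟫_ℝ) := by
    simp only [hZ, inner_sub_left, inner_sub_right, inner_smul_left, inner_smul_right,
      real_inner_comm X Y, conj_trivial]
    ring
  rw [this] at hZZ
  exact pos_of_mul_pos_right hZZ hXX.le

theorem triple_ne_zero {n X Y : E3} (hn : ⟪n, n⟫_ℝ = 1) (hX : ⟪X, n⟫_ℝ = 0)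
    (hY : ⟪Y, n⟫_ℝ = 0) (h : LinearIndependent ℝ ![X, Y]) : triple n X Y ≠ 0 := by
  intro h0
  have := gram_pos h
  rw [← triple_sq_of_orthogonal hn hX hY, h0] at this
  simp at this

/-- `tr (I⁻¹ II)` for explicit two by two matrices. -/
theorem trace_inv_mul_fin_two (g b : Matrix (Fin 2) (Fin 2) ℝ) :
    (g⁻¹ * b).trace =
      (g 1 1 * b 0 0 - g 0 1 * b 1 0 - g 1 0 * b 0 1 + g 0 0 * b 1 1) /
        (g 0 0 * g 1 1 - g 0 1 * g 1 0) := by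
  rw [Matrix.inv_def, Matrix.adjugate_fin_two, Matrix.det_fin_two, Matrix.trace_fin_two]
  simp [Matrix.mul_apply, Fin.sum_univ_two]
  ring

/-- The relation `dN ∧ dψ = -2H dψ ∧ dψ` in terms of tangent vectors: `A, B` are the
derivatives of the unit normal in two directions where `ψ` has derivatives `X, Y`. -/
theorem triple_shape {n X Y A B : E3} (v : E3) (hn : ⟪n, n⟫_ℝ = 1) (hX : ⟪X, n⟫_ℝ = 0)
    (hY : ⟪Y, n⟫_ℝ = 0) (hA : ⟪A, n⟫_ℝ = 0) (hB : ⟪B, n⟫_ℝ = 0)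
    (h : LinearIndependent ℝ ![X, Y]) :
    triple v A Y - triple v B X =
      (⟪Y, Y⟫_ℝ * ⟪A, X⟫_ℝ - ⟪X, Y⟫_ℝ * ⟪B, X⟫_ℝ - ⟪Y, X⟫_ℝ * ⟪A, Y⟫_ℝ
        + ⟪X, X⟫_ℝ * ⟪B, Y⟫_ℝ) / (⟪X, X⟫_ℝ * ⟪Y, Y⟫_ℝ - ⟪X, Y⟫_ℝ * ⟪Y, X⟫_ℝ)
        * triple v X Y := by
  have hJ := triple_ne_zero hn hX hY h
  rw [triple_of_orthogonal v hn hA hY, triple_of_orthogonal v hn hB hX,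
    triple_of_orthogonal v hn hX hY, ← triple_sq_of_orthogonal hn hX hY]
  have hX' : ⟪n, X⟫_ℝ = 0 := by rw [real_inner_comm, hX]
  have hY' : ⟪n, Y⟫_ℝ = 0 := by rw [real_inner_comm, hY]
  -- Multiplying by `triple n X Y` turns triple products into inner products: since `n` is
  -- orthogonal to `X` and `Y`, only one minor of the Gram determinant survives.
  have h1 : triple n A Y * triple n X Y = ⟪A, X⟫_ℝ * ⟪Y, Y⟫_ℝ - ⟪A, Y⟫_ℝ * ⟪Y, X⟫_ℝ := by
    rw [triple_mul_triple, hn, hX', hY']; ring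
  have h2 : triple n B X * triple n X Y = ⟪B, X⟫_ℝ * ⟪X, Y⟫_ℝ - ⟪B, Y⟫_ℝ * ⟪X, X⟫_ℝ := by
    rw [triple_mul_triple, hn, hX', hY']; ring
  field_simp
  linear_combination ⟪n, v⟫_ℝ * (h1 - h2)

/-! ### Linear algebra of the model plane -/

/-- The Euclidean plane. -/
abbrev E2 : Type := EuclideanSpace ℝ (Fin 2)

/-- The standard basis of the plane. -/
noncomputable def stdVec (i : Fin 2) : E2 := EuclideanSpace.single i (1 : ℝ)

theorem eq_sum_stdVec (a : E2) : a = a 0 • stdVec 0 + a 1 • stdVec 1 := by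
  ext i
  fin_cases i <;> simp [stdVec]

theorem map_eq_sum_stdVec {F : Type*} [NormedAddCommGroup F] [NormedSpace ℝ F] (L : E2 →L[ℝ] F)
    (a : E2) : L a = a 0 • L (stdVec 0) + a 1 • L (stdVec 1) := by
  conv_lhs => rw [eq_sum_stdVec a]
  simp only [map_add, map_smul]

/-- An alternating form on the plane is a multiple of the determinant. This reduces identities
between two-forms to the standard basis and produces the Jacobian under a change of frame. -/
theorem triple_map_map (v : E3) (L : E2 →L[ℝ] E3) (a b : E2) :
    triple v (L a) (L b) =
      (a 0 * b 1 - a 1 * b 0) * triple v (L (stdVec 0)) (L (stdVec 1)) := by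
  rw [map_eq_sum_stdVec L a, map_eq_sum_stdVec L b]
  simp only [map_add, map_smul, add_apply, smul_apply,
    smul_eq_mul, triple_self, triple_swap v (L (stdVec 1)) (L (stdVec 0))]
  ring

theorem wedge_map_map (α β : E2 →L[ℝ] ℝ) (a b : E2) :
    α a * β b - α b * β a =
      (a 0 * b 1 - a 1 * b 0) *
        (α (stdVec 0) * β (stdVec 1) - α (stdVec 1) * β (stdVec 0)) := by
  rw [map_eq_sum_stdVec α a, map_eq_sum_stdVec α b, map_eq_sum_stdVec β a, map_eq_sum_stdVec β b]
  simp only [smul_eq_mul]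
  ring

theorem det_map_stdVec (T : E2 →L[ℝ] E2) :
    T.det = T (stdVec 0) 0 * T (stdVec 1) 1 - T (stdVec 0) 1 * T (stdVec 1) 0 := by
  have := LinearMap.det_toMatrix (EuclideanSpace.basisFun (Fin 2) ℝ).toBasis (T : E2 →ₗ[ℝ] E2)
  rw [ContinuousLinearMap.det, ← this, Matrix.det_fin_two]
  simp [LinearMap.toMatrix_apply, stdVec]
  ring

theorem linearIndependent_stdVec : LinearIndependent ℝ ![stdVec 0, stdVec 1] := by
  rw [LinearIndependent.pair_iff]
  intro s t h
  have h0 := congrArg (fun z : E2 => z 0) h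
  have h1 := congrArg (fun z : E2 => z 1) h
  simp [stdVec] at h0 h1
  exact ⟨h0, h1⟩

theorem linearIndependent_map_stdVec {L : E2 →L[ℝ] E3} (hL : Function.Injective L) :
    LinearIndependent ℝ ![L (stdVec 0), L (stdVec 1)] := by
  have := linearIndependent_stdVec.map' (L : E2 →ₗ[ℝ] E3) (LinearMap.ker_eq_bot.2 hL)
  have e : ![L (stdVec 0), L (stdVec 1)] = (L : E2 →ₗ[ℝ] E3) ∘ ![stdVec 0, stdVec 1] := by
    funext i
    fin_cases i <;> rfl
  rw [e]
  exact this

theorem inner_gauss_self {M : Type*} (N : M → S2) (p : M) : ⟪(N p : E3), (N p : E3)⟫_ℝ = 1 := by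
  rw [real_inner_self_eq_norm_sq, norm_eq_of_mem_sphere]
  norm_num

/-! ### Pointwise geometry of an oriented immersion -/

section PointwiseGeometry

variable {M : Type*} [TopologicalSpace M] [ChartedSpace (EuclideanSpace ℝ (Fin 2)) M]
  {ψ : M → E3} {N : M → S2}

/-- The differential `diffAt`, with the tangent space replaced by the model plane. -/
noncomputable def planeDiff (f : M → E3) (p : M) : E2 →L[ℝ] E3 := diffAt f p

namespace IsOrientedImmersion

theorem inner_planeDiff_gauss (h : IsOrientedImmersion ψ N) (p : M) (a : E2) :
    ⟪planeDiff ψ p a, (N p : E3)⟫_ℝ = 0 := h.normal p a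

theorem continuous_gauss (h : IsOrientedImmersion ψ N) : Continuous N :=
  continuous_induced_rng.2 h.contMDiff_gauss.continuous

theorem mdifferentiableAt_gauss (h : IsOrientedImmersion ψ N) (p : M) :
    MDifferentiableAt (𝓡 2) 𝓘(ℝ, E3) (fun q => (N q : E3)) p :=
  (h.contMDiff_gauss p).mdifferentiableAt (by simp)

theorem mdifferentiableAt (h : IsOrientedImmersion ψ N) (p : M) :
    MDifferentiableAt (𝓡 2) 𝓘(ℝ, E3) ψ p :=
  (h.contMDiff p).mdifferentiableAt (by simp)

/-- Differentiate `‖N‖² = 1`. -/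
theorem inner_planeDiff_gauss_gauss (h : IsOrientedImmersion ψ N) (p : M) (a : E2) :
    ⟪planeDiff (fun q => (N q : E3)) p a, (N p : E3)⟫_ℝ = 0 := by
  have h1 := (h.mdifferentiableAt_gauss p).hasMFDerivAt
  have h2 : HasMFDerivAt 𝓘(ℝ, E3) 𝓘(ℝ, ℝ) (fun x : E3 => ‖x‖ ^ 2) (N p : E3)
      (2 • innerSL ℝ (N p : E3)) := (hasStrictFDerivAt_norm_sq _).hasFDerivAt.hasMFDerivAt
  have h3 := h2.comp p h1
  have h4 : (fun x : E3 => ‖x‖ ^ 2) ∘ (fun q => (N q : E3)) = fun _ : M => (1 : ℝ) := by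
    funext q; simp
  rw [h4] at h3
  have h5 := hasMFDerivAt_unique h3 (hasMFDerivAt_const (1 : ℝ) p)
  have h6 : (2 • innerSL ℝ (N p : E3)) (planeDiff (fun q => (N q : E3)) p a) = 0 :=
    DFunLike.congr_fun h5 a
  rw [real_inner_comm]
  simpa using h6

theorem linearIndependent_planeDiff (h : IsOrientedImmersion ψ N) (p : M) :
    LinearIndependent ℝ ![planeDiff ψ p (stdVec 0), planeDiff ψ p (stdVec 1)] :=
  linearIndependent_map_stdVec (L := planeDiff ψ p) (h.injective p)

/-- Both sides are alternating in `a, b`, so `triple_shape` on the standard basis suffices. General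
`a, b` are needed for the frame vectors of a chart. -/
theorem triple_shape_planeDiff (h : IsOrientedImmersion ψ N) (p : M) (v : E3) (a b : E2) :
    triple v (planeDiff (fun q => (N q : E3)) p a) (planeDiff ψ p b)
      - triple v (planeDiff (fun q => (N q : E3)) p b) (planeDiff ψ p a) =
    -(2 * meanCurvature ψ N p) * triple v (planeDiff ψ p a) (planeDiff ψ p b) := by
  have key := triple_shape v (inner_gauss_self N p) (h.inner_planeDiff_gauss p (stdVec 0))
    (h.inner_planeDiff_gauss p (stdVec 1)) (h.inner_planeDiff_gauss_gauss p (stdVec 0))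
    (h.inner_planeDiff_gauss_gauss p (stdVec 1)) (h.linearIndependent_planeDiff p)
  have hH : (⟪planeDiff ψ p (stdVec 1), planeDiff ψ p (stdVec 1)⟫_ℝ *
        ⟪planeDiff (fun q => (N q : E3)) p (stdVec 0), planeDiff ψ p (stdVec 0)⟫_ℝ
      - ⟪planeDiff ψ p (stdVec 0), planeDiff ψ p (stdVec 1)⟫_ℝ *
        ⟪planeDiff (fun q => (N q : E3)) p (stdVec 1), planeDiff ψ p (stdVec 0)⟫_ℝ
      - ⟪planeDiff ψ p (stdVec 1), planeDiff ψ p (stdVec 0)⟫_ℝ *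
        ⟪planeDiff (fun q => (N q : E3)) p (stdVec 0), planeDiff ψ p (stdVec 1)⟫_ℝ
      + ⟪planeDiff ψ p (stdVec 0), planeDiff ψ p (stdVec 0)⟫_ℝ *
        ⟪planeDiff (fun q => (N q : E3)) p (stdVec 1), planeDiff ψ p (stdVec 1)⟫_ℝ) /
      (⟪planeDiff ψ p (stdVec 0), planeDiff ψ p (stdVec 0)⟫_ℝ *
        ⟪planeDiff ψ p (stdVec 1), planeDiff ψ p (stdVec 1)⟫_ℝ
      - ⟪planeDiff ψ p (stdVec 0), planeDiff ψ p (stdVec 1)⟫_ℝ *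
        ⟪planeDiff ψ p (stdVec 1), planeDiff ψ p (stdVec 0)⟫_ℝ) =
      -(2 * meanCurvature ψ N p) := by
    rw [meanCurvature, trace_inv_mul_fin_two]
    simp only [firstForm, secondForm, Matrix.of_apply]
    change _ = -(2 * (1 / 2 * ((⟪planeDiff ψ p (stdVec 1), planeDiff ψ p (stdVec 1)⟫_ℝ *
        -⟪planeDiff (fun q => (N q : E3)) p (stdVec 0), planeDiff ψ p (stdVec 0)⟫_ℝ
      - ⟪planeDiff ψ p (stdVec 0), planeDiff ψ p (stdVec 1)⟫_ℝ *
        -⟪planeDiff (fun q => (N q : E3)) p (stdVec 1), planeDiff ψ p (stdVec 0)⟫_ℝ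
      - ⟪planeDiff ψ p (stdVec 1), planeDiff ψ p (stdVec 0)⟫_ℝ *
        -⟪planeDiff (fun q => (N q : E3)) p (stdVec 0), planeDiff ψ p (stdVec 1)⟫_ℝ
      + ⟪planeDiff ψ p (stdVec 0), planeDiff ψ p (stdVec 0)⟫_ℝ *
        -⟪planeDiff (fun q => (N q : E3)) p (stdVec 1), planeDiff ψ p (stdVec 1)⟫_ℝ) /
      (⟪planeDiff ψ p (stdVec 0), planeDiff ψ p (stdVec 0)⟫_ℝ *
        ⟪planeDiff ψ p (stdVec 1), planeDiff ψ p (stdVec 1)⟫_ℝ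
      - ⟪planeDiff ψ p (stdVec 0), planeDiff ψ p (stdVec 1)⟫_ℝ *
        ⟪planeDiff ψ p (stdVec 1), planeDiff ψ p (stdVec 0)⟫_ℝ))))
    ring
  rw [hH] at key
  rw [triple_map_map v (planeDiff ψ p) a b]
  rw [map_eq_sum_stdVec (planeDiff ψ p) a, map_eq_sum_stdVec (planeDiff ψ p) b,
    map_eq_sum_stdVec (planeDiff (fun q => (N q : E3)) p) a,
    map_eq_sum_stdVec (planeDiff (fun q => (N q : E3)) p) b]
  simp only [map_add, map_smul, add_apply, smul_apply, smul_eq_mul]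
  linear_combination (a 0 * b 1 - a 1 * b 0) * key

theorem triple_planeDiff (h : IsOrientedImmersion ψ N) (p : M) (v : E3) (a b : E2) :
    triple v (planeDiff ψ p a) (planeDiff ψ p b) =
      triple (N p) (planeDiff ψ p a) (planeDiff ψ p b) * ⟪(N p : E3), v⟫_ℝ :=
  triple_of_orthogonal v (inner_gauss_self N p) (h.inner_planeDiff_gauss p a)
    (h.inner_planeDiff_gauss p b)

/-- A comparison of the two fundamental forms bounds the mean curvature: if
`c II ≤ -κ I` then `c H ≤ -κ`. -/
theorem meanCurvature_le_of_form_le (h : IsOrientedImmersion ψ N) (p : M) {c κ : ℝ}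
    (hle : ∀ a : E2, κ * ⟪planeDiff ψ p a, planeDiff ψ p a⟫_ℝ
      - c * ⟪planeDiff (fun q => (N q : E3)) p a, planeDiff ψ p a⟫_ℝ ≤ 0) :
    c * meanCurvature ψ N p ≤ -κ := by
  set X := planeDiff ψ p (stdVec 0) with hX
  set Y := planeDiff ψ p (stdVec 1) with hY
  set A := planeDiff (fun q => (N q : E3)) p (stdVec 0) with hA
  set B := planeDiff (fun q => (N q : E3)) p (stdVec 1) with hB
  have hd : 0 < ⟪X, X⟫_ℝ * ⟪Y, Y⟫_ℝ - ⟪X, Y⟫_ℝ * ⟪Y, X⟫_ℝ :=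
    gram_pos (h.linearIndependent_planeDiff p)
  have hXX : 0 < ⟪X, X⟫_ℝ :=
    real_inner_self_pos.2 ((h.linearIndependent_planeDiff p).ne_zero 0)
  have hH : meanCurvature ψ N p = (1 / 2) * ((⟪Y, Y⟫_ℝ * -⟪A, X⟫_ℝ - ⟪X, Y⟫_ℝ * -⟪B, X⟫_ℝ
      - ⟪Y, X⟫_ℝ * -⟪A, Y⟫_ℝ + ⟪X, X⟫_ℝ * -⟪B, Y⟫_ℝ) /
      (⟪X, X⟫_ℝ * ⟪Y, Y⟫_ℝ - ⟪X, Y⟫_ℝ * ⟪Y, X⟫_ℝ)) := by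
    rw [meanCurvature, trace_inv_mul_fin_two]
    rfl
  have hYX : ⟪Y, X⟫_ℝ = ⟪X, Y⟫_ℝ := real_inner_comm _ _
  have h0 := hle (stdVec 0)
  -- Gram–Schmidt: this vector is sent to `Z = |X|² Y - ⟨X, Y⟩ X`, orthogonal to `X`, with `|Z|² =
  -- |X|² d` for the Gram determinant `d`. The trace of the shape operator is `II(X, X)/|X|² + II(Z,
  -- Z)/|Z|²`, so the bound comes from `d * h0 + h1`.
  have h1 := hle (-⟪X, Y⟫_ℝ • stdVec 0 + ⟪X, X⟫_ℝ • stdVec 1)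
  simp only [map_add, map_smul, ← hX, ← hY, ← hA, ← hB, inner_add_left, inner_add_right,
    inner_smul_left, inner_smul_right, conj_trivial, hYX] at h0 h1
  rw [hH, hYX]
  rw [hYX] at hd
  have h2 : ⟪X, X⟫_ℝ * (c * (⟪Y, Y⟫_ℝ * -⟪A, X⟫_ℝ - ⟪X, Y⟫_ℝ * -⟪B, X⟫_ℝ
      - ⟪X, Y⟫_ℝ * -⟪A, Y⟫_ℝ + ⟪X, X⟫_ℝ * -⟪B, Y⟫_ℝ)
      + 2 * κ * (⟪X, X⟫_ℝ * ⟪Y, Y⟫_ℝ - ⟪X, Y⟫_ℝ * ⟪X, Y⟫_ℝ)) ≤ 0 := by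
    have h3 := mul_nonpos_of_nonneg_of_nonpos hd.le h0
    linarith
  have h3 := nonpos_of_mul_nonpos_right h2 hXX
  have h4 : c * (1 / 2 * ((⟪Y, Y⟫_ℝ * -⟪A, X⟫_ℝ - ⟪X, Y⟫_ℝ * -⟪B, X⟫_ℝ
      - ⟪X, Y⟫_ℝ * -⟪A, Y⟫_ℝ + ⟪X, X⟫_ℝ * -⟪B, Y⟫_ℝ) /
      (⟪X, X⟫_ℝ * ⟪Y, Y⟫_ℝ - ⟪X, Y⟫_ℝ * ⟪X, Y⟫_ℝ))) =
      (c * (⟪Y, Y⟫_ℝ * -⟪A, X⟫_ℝ - ⟪X, Y⟫_ℝ * -⟪B, X⟫_ℝ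
      - ⟪X, Y⟫_ℝ * -⟪A, Y⟫_ℝ + ⟪X, X⟫_ℝ * -⟪B, Y⟫_ℝ) / 2) /
      (⟪X, X⟫_ℝ * ⟪Y, Y⟫_ℝ - ⟪X, Y⟫_ℝ * ⟪X, Y⟫_ℝ) := by ring
  rw [h4, div_le_iff₀ hd]
  linarith

end IsOrientedImmersion

end PointwiseGeometry

/-! ### Immersions read in charts -/

section Charts

open Set Topology MeasureTheory

variable {M : Type*} [TopologicalSpace M] [ChartedSpace (EuclideanSpace ℝ (Fin 2)) M]

/-- A function on `M` read in the preferred chart at `c`. -/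
noncomputable def pull {F : Type*} (c : M) (f : M → F) (y : E2) : F := f ((chartAt E2 c).symm y)

/-- The coordinate frame of the preferred chart at `c`. -/
noncomputable def frame (c : M) (y : E2) : E2 →L[ℝ] E2 :=
  mfderiv (𝓡 2) (𝓡 2) (chartAt E2 c).symm y

/-- The differential of a real function, with the tangent space replaced by the model plane. -/
noncomputable def planeDiffReal (f : M → ℝ) (p : M) : E2 →L[ℝ] ℝ := mfderiv (𝓡 2) 𝓘(ℝ, ℝ) f p

section

variable {F : Type*} [NormedAddCommGroup F] [NormedSpace ℝ F] [IsManifold (𝓡 2) ∞ M]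

theorem hasFDerivAt_pull {f : M → F} {c : M} {y : E2} (hy : y ∈ (chartAt E2 c).target)
    {L : E2 →L[ℝ] F}
    (hf : HasMFDerivAt (𝓡 2) 𝓘(ℝ, F) f ((chartAt E2 c).symm y) L) :
    HasFDerivAt (pull c f) (L.comp (frame c y)) y := by
  have : IsManifold (𝓡 2) 1 M := IsManifold.of_le (n := ∞) (by simp)
  have h1 := ((mdifferentiable_chart (I := 𝓡 2) c).mdifferentiableAt_symm hy).hasMFDerivAt
  exact (hf.comp y h1).hasFDerivAt

theorem frame_injective {c : M} {y : E2} (hy : y ∈ (chartAt E2 c).target) :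
    Function.Injective (frame c y) := by
  have : IsManifold (𝓡 2) 1 M := IsManifold.of_le (n := ∞) (by simp)
  have h1 := (mdifferentiable_chart (I := 𝓡 2) c).comp_symm_deriv hy
  intro a b hab
  have h2 := DFunLike.congr_fun h1 a
  have h3 := DFunLike.congr_fun h1 b
  have h4 : (mfderiv (𝓡 2) (𝓡 2) (chartAt E2 c) ((chartAt E2 c).symm y)) (frame c y a) = a := h2
  have h5 : (mfderiv (𝓡 2) (𝓡 2) (chartAt E2 c) ((chartAt E2 c).symm y)) (frame c y b) = b := h3
  rw [← h4, ← h5, hab]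

theorem contDiffOn_pull {f : M → F} (c : M) {n : ℕ∞} (hf : ContMDiff (𝓡 2) 𝓘(ℝ, F) n f) :
    ContDiffOn ℝ n (pull c f) (chartAt E2 c).target := by
  have : IsManifold (𝓡 2) n M := IsManifold.of_le (n := ∞) (by exact_mod_cast le_top)
  rw [← contMDiffOn_iff_contDiffOn]
  exact hf.comp_contMDiffOn contMDiffOn_chart_symm

end

theorem continuousOn_pull {F : Type*} [TopologicalSpace F] {f : M → F} (c : M)
    (hf : Continuous f) : ContinuousOn (pull c f) (chartAt E2 c).target :=
  hf.comp_continuousOn (chartAt E2 c).continuousOn_symm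

variable {ψ : M → E3} {N : M → S2}

/-- The signed area density of an oriented immersion in the preferred chart at `c`. -/
noncomputable def density (ψ : M → E3) (N : M → S2) (c : M) (y : E2) : ℝ :=
  triple (pull c (fun q => (N q : E3)) y) (planeDiff ψ ((chartAt E2 c).symm y) (frame c y (stdVec 0)))
    (planeDiff ψ ((chartAt E2 c).symm y) (frame c y (stdVec 1)))

/-- The integral against the area measure of a function supported in the domain of the
preferred chart at `c`. -/
noncomputable def chartIntegral (ψ : M → E3) (N : M → S2) (c : M) (g : M → ℝ) : ℝ :=
  ∫ y in (chartAt E2 c).target, pull c g y * |density ψ N c y|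

variable [IsManifold (𝓡 2) ∞ M]

namespace IsOrientedImmersion

theorem hasFDerivAt_pull_immersion (h : IsOrientedImmersion ψ N) {c : M} {y : E2}
    (hy : y ∈ (chartAt E2 c).target) :
    HasFDerivAt (pull c ψ) ((planeDiff ψ ((chartAt E2 c).symm y)).comp (frame c y)) y :=
  hasFDerivAt_pull hy (h.mdifferentiableAt _).hasMFDerivAt

theorem hasFDerivAt_pull_gauss (h : IsOrientedImmersion ψ N) {c : M} {y : E2}
    (hy : y ∈ (chartAt E2 c).target) :
    HasFDerivAt (pull c fun q => (N q : E3))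
      ((planeDiff (fun q => (N q : E3)) ((chartAt E2 c).symm y)).comp (frame c y)) y :=
  hasFDerivAt_pull hy (h.mdifferentiableAt_gauss _).hasMFDerivAt

theorem contDiffOn_fderiv_pull_immersion (h : IsOrientedImmersion ψ N) (c : M) :
    ContDiffOn ℝ 1 (fderiv ℝ (pull c ψ)) (chartAt E2 c).target :=
  (contDiffOn_pull (n := 2) c h.contMDiff).fderiv_of_isOpen (chartAt E2 c).open_target
    (by norm_num)

theorem density_ne_zero (h : IsOrientedImmersion ψ N) {c : M} {y : E2}
    (hy : y ∈ (chartAt E2 c).target) : density ψ N c y ≠ 0 := by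
  refine triple_ne_zero (inner_gauss_self N _) (h.inner_planeDiff_gauss _ _)
    (h.inner_planeDiff_gauss _ _) ?_
  exact linearIndependent_map_stdVec
    (L := (planeDiff ψ ((chartAt E2 c).symm y)).comp (frame c y))
    ((h.injective _).comp (frame_injective hy))

/-- `planeDiff` and `frame` separately need not be continuous, since the tangent space at each point
is read in the preferred chart of that point. Their composition is the derivative of `pull c ψ`,
which is continuous. -/
theorem continuousOn_density (h : IsOrientedImmersion ψ N) (c : M) :
    ContinuousOn (density ψ N c) (chartAt E2 c).target := by
  have h1 : ContinuousOn (fderiv ℝ (pull c ψ)) (chartAt E2 c).target :=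
    (h.contDiffOn_fderiv_pull_immersion c).continuousOn
  have h2 : ContinuousOn (fun y => (pull c (fun q => (N q : E3)) y)) (chartAt E2 c).target :=
    continuousOn_pull c h.contMDiff_gauss.continuous
  have h3 : ContinuousOn (fun y => triple (pull c (fun q => (N q : E3)) y) (fderiv ℝ (pull c ψ) y (stdVec 0))
      (fderiv ℝ (pull c ψ) y (stdVec 1))) (chartAt E2 c).target := by
    have ha := h1.clm_apply (continuousOn_const (c := stdVec 0))
    have hb := h1.clm_apply (continuousOn_const (c := stdVec 1))
    simp only [triple_apply]
    fun_prop
  refine h3.congr fun y hy => ?_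
  simp only [(h.hasFDerivAt_pull_immersion hy).fderiv]
  rfl

end IsOrientedImmersion

end Charts

/-! ### Chart independence of the area integral -/

section Integration

open Set Topology MeasureTheory

variable {M : Type*} [TopologicalSpace M] [ChartedSpace (EuclideanSpace ℝ (Fin 2)) M]
  {ψ : M → E3} {N : M → S2}

/-- The derivative of a change of charts. -/
noncomputable def transitionDeriv (c d : M) (y : E2) : E2 →L[ℝ] E2 :=
  (mfderiv (𝓡 2) (𝓡 2) (chartAt E2 d) ((chartAt E2 c).symm y) : E2 →L[ℝ] E2).comp (frame c y)

variable [IsManifold (𝓡 2) ∞ M]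

theorem hasFDerivAt_transition {c d : M} {y : E2}
    (hy : y ∈ ((chartAt E2 c).symm.trans (chartAt E2 d)).source) :
    HasFDerivAt ((chartAt E2 c).symm.trans (chartAt E2 d)) (transitionDeriv c d y) y := by
  have : IsManifold (𝓡 2) 1 M := IsManifold.of_le (n := ∞) (by simp)
  rw [OpenPartialHomeomorph.trans_source] at hy
  have hy1 : y ∈ (chartAt E2 c).target := hy.1
  have hy2 : (chartAt E2 c).symm y ∈ (chartAt E2 d).source := hy.2
  exact hasFDerivAt_pull (f := chartAt E2 d) hy1
    ((mdifferentiable_chart (I := 𝓡 2) d).mdifferentiableAt hy2).hasMFDerivAt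

/-- The frame of `c` is the frame of `d` composed with the transition derivative, and an alternating
form picks up its determinant. -/
theorem density_transition {c d : M} {y : E2}
    (hy : y ∈ ((chartAt E2 c).symm.trans (chartAt E2 d)).source) :
    density ψ N c y = (transitionDeriv c d y).det *
      density ψ N d (((chartAt E2 c).symm.trans (chartAt E2 d)) y) := by
  have : IsManifold (𝓡 2) 1 M := IsManifold.of_le (n := ∞) (by simp)
  rw [OpenPartialHomeomorph.trans_source] at hy
  have hy2 : (chartAt E2 c).symm y ∈ (chartAt E2 d).source := hy.2
  have h1 := (mdifferentiable_chart (I := 𝓡 2) d).symm_comp_deriv hy2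
  have h2 : ∀ a, frame c y a =
      frame d (chartAt E2 d ((chartAt E2 c).symm y)) (transitionDeriv c d y a) :=
    fun a => (DFunLike.congr_fun h1 (frame c y a)).symm
  have h3 : ((chartAt E2 c).symm.trans (chartAt E2 d)) y =
    chartAt E2 d ((chartAt E2 c).symm y) := rfl
  have h4 : (chartAt E2 d).symm (chartAt E2 d ((chartAt E2 c).symm y)) = (chartAt E2 c).symm y :=
    (chartAt E2 d).left_inv hy2
  rw [h3, density, density, h2, h2, pull, pull, h4]
  have := triple_map_map (N ((chartAt E2 c).symm y) : E3)
    ((planeDiff ψ ((chartAt E2 c).symm y)).comp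
      (frame d (chartAt E2 d ((chartAt E2 c).symm y))))
    (transitionDeriv c d y (stdVec 0)) (transitionDeriv c d y (stdVec 1))
  rw [det_map_stdVec]
  exact this

/-- The area integral of a function does not depend on the chart that is used. -/
theorem chartIntegral_eq_of_support (ψ : M → E3) (N : M → S2) {c d : M} {g : M → ℝ}
    (hc : Function.support g ⊆ (chartAt E2 c).source)
    (hd : Function.support g ⊆ (chartAt E2 d).source) :
    chartIntegral ψ N c g = chartIntegral ψ N d g := by
  -- Both integrals live on the overlap of the charts, where the change of variables formula
  -- applies; its `|det|` is the factor relating the two values of `|density|`.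
  have restrict : ∀ (c d : M), Function.support g ⊆ (chartAt E2 d).source →
      chartIntegral ψ N c g =
        ∫ y in ((chartAt E2 c).symm.trans (chartAt E2 d)).source,
          pull c g y * |density ψ N c y| := by
    intro c d hd
    refine setIntegral_eq_of_subset_of_forall_sdiff_eq_zero
      (chartAt E2 c).open_target.measurableSet ?_ ?_
    · rw [OpenPartialHomeomorph.trans_source]
      exact inter_subset_left
    · rintro y ⟨hy, hy'⟩
      have : pull c g y = 0 := by
        by_contra h0
        refine hy' ?_
        rw [OpenPartialHomeomorph.trans_source]
        exact ⟨hy, hd h0⟩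
      rw [this, zero_mul]
  rw [restrict c d hd, restrict d c hc]
  set τ := (chartAt E2 c).symm.trans (chartAt E2 d) with hτ
  have himg : ((chartAt E2 d).symm.trans (chartAt E2 c)).source = τ '' τ.source := by
    rw [τ.image_source_eq_target, hτ, OpenPartialHomeomorph.trans_source,
      OpenPartialHomeomorph.trans_target]
    rfl
  rw [himg, integral_image_eq_integral_abs_det_fderiv_smul volume τ.open_source.measurableSet
    (fun y hy => (hasFDerivAt_transition hy).hasFDerivWithinAt) τ.injOn]
  refine setIntegral_congr_fun τ.open_source.measurableSet fun y hy => ?_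
  have h5 : pull d g (τ y) = pull c g y := by
    rw [hτ, OpenPartialHomeomorph.trans_source] at hy
    exact congrArg g ((chartAt E2 d).left_inv hy.2)
  change pull c g y * |density ψ N c y| =
    |(transitionDeriv c d y).det| * (pull d g (τ y) * |density ψ N d (τ y)|)
  rw [h5, density_transition hy, abs_mul]
  ring

end Integration

/-! ### Integrals of derivatives with compact support -/

section CompactSupport

open Set Topology MeasureTheory

theorem integrableOn_of_eq_zero_off_compact {U K : Set E2} {f : E2 → ℝ} (hU : IsOpen U)
    (hK : IsCompact K) (hKU : K ⊆ U) (hf : ContinuousOn f U) (h0 : ∀ y ∈ U, y ∉ K → f y = 0) :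
    IntegrableOn f U :=
  ((hf.mono hKU).integrableOn_compact hK).of_forall_sdiff_eq_zero hU.measurableSet
    fun y hy => h0 y hy.1 hy.2

theorem integral_fderiv_eq_zero_of_hasCompactSupport {f : E2 → ℝ} (hf : ContDiff ℝ 1 f)
    (hc : HasCompactSupport f) (w : E2) : ∫ y, fderiv ℝ f y w = 0 := by
  have hcont : Continuous fun y => fderiv ℝ f y w :=
    (hf.continuous_fderiv (by simp)).clm_apply continuous_const
  have hint : Integrable fun y => fderiv ℝ f y w :=
    hcont.integrable_of_hasCompactSupport (hc.fderiv_apply (𝕜 := ℝ) w)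
  have hint' : Integrable f := hf.continuous.integrable_of_hasCompactSupport hc
  -- Integration by parts against the constant `1`.
  have := integral_mul_fderiv_eq_neg_fderiv_mul_of_integrable (μ := volume) (f := fun _ : E2 => (1 : ℝ))
    (g := f) (v := w) (by simp) (by simpa using hint) (by simpa using hint')
    (fun x _ => by fun_prop) (fun x _ => (hf.differentiable (by simp)).differentiableAt)
  simpa using this

/-- The integral of a directional derivative of a function with compact support in an open
set vanishes. -/
theorem setIntegral_fderiv_eq_zero {U K : Set E2} {f : E2 → ℝ} (hU : IsOpen U)
    (hK : IsCompact K) (hKU : K ⊆ U) (hf : ContDiffOn ℝ 1 f U) (h0 : ∀ y ∈ U, y ∉ K → f y = 0)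
    (w : E2) : ∫ y in U, fderiv ℝ f y w = 0 := by
  -- The extension by zero is `C¹` on the whole plane because the open sets `U` and `Kᶜ` cover it.
  set F := U.indicator f with hF
  have hFK : ∀ y ∉ K, F y = 0 := by
    intro y hy
    by_cases hyU : y ∈ U
    · rw [hF, indicator_of_mem hyU, h0 y hyU hy]
    · rw [hF, indicator_of_notMem hyU]
  have hFf : ∀ y ∈ U, F =ᶠ[𝓝 y] f := fun y hy =>
    Filter.eventuallyEq_of_mem (hU.mem_nhds hy) fun z hz => indicator_of_mem hz f
  have hF0 : ∀ y ∉ K, F =ᶠ[𝓝 y] fun _ => 0 := fun y hy =>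
    Filter.eventuallyEq_of_mem (hK.isClosed.isOpen_compl.mem_nhds hy) fun z hz => hFK z hz
  have hFc : ContDiff ℝ 1 F := by
    rw [contDiff_iff_contDiffAt]
    intro y
    by_cases hy : y ∈ U
    · exact ((hf.contDiffAt (hU.mem_nhds hy))).congr_of_eventuallyEq (hFf y hy)
    · exact contDiffAt_const.congr_of_eventuallyEq (hF0 y fun h => hy (hKU h))
  have h1 : ∫ y in U, fderiv ℝ F y w = ∫ y, fderiv ℝ F y w := by
    refine setIntegral_eq_integral_of_forall_compl_eq_zero fun y hy => ?_
    rw [(hF0 y fun h => hy (hKU h)).fderiv_eq]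
    simp
  rw [← integral_fderiv_eq_zero_of_hasCompactSupport hFc (HasCompactSupport.intro hK hFK) w, ← h1]
  refine setIntegral_congr_fun hU.measurableSet fun y hy => ?_
  simp only [(hFf y hy).fderiv_eq]

end CompactSupport

/-! ### The flux form and its differential -/

section Stokes

open Set Topology MeasureTheory

variable {M : Type*} [TopologicalSpace M] [ChartedSpace (EuclideanSpace ℝ (Fin 2)) M]
  {ψ : M → E3} {N : M → S2}

/-- The one-form `(1/2) ⟨N × dψ, v⟩ + (lam/2) ⟨ψ × dψ, v⟩`, up to the sign convention of
`triple`. Its differential is `(lam - H) ⟨N, v⟩ dA`. -/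
noncomputable def fluxForm (ψ : M → E3) (N : M → S2) (v : E3) (lam : ℝ) (p : M) : E2 →L[ℝ] ℝ :=
  ((1 / 2 : ℝ) • triple v (N p) + (lam / 2) • triple v (ψ p)).comp (planeDiff ψ p)

/-- The density with respect to the area form of the differential of `ρ • fluxForm`. -/
noncomputable def fluxDiv (ψ : M → E3) (N : M → S2) (v : E3) (lam : ℝ) (ρ : M → ℝ) (p : M) : ℝ :=
  ρ p * ((lam - meanCurvature ψ N p) * ⟪(N p : E3), v⟫_ℝ) +
    (planeDiffReal ρ p (stdVec 0) * fluxForm ψ N v lam p (stdVec 1)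
      - planeDiffReal ρ p (stdVec 1) * fluxForm ψ N v lam p (stdVec 0)) /
      triple (N p) (planeDiff ψ p (stdVec 0)) (planeDiff ψ p (stdVec 1))

/-- A component of `fluxForm` in the preferred chart at `c`. -/
noncomputable def fluxCoeff (ψ : M → E3) (N : M → S2) (v : E3) (lam : ℝ) (c : M) (w y : E2) : ℝ :=
  (1 / 2) * triple v (pull c (fun q => (N q : E3)) y) (fderiv ℝ (pull c ψ) y w)
    + (lam / 2) * triple v (pull c ψ y) (fderiv ℝ (pull c ψ) y w)

theorem support_fluxDiv_subset (v : E3) (lam : ℝ) (ρ : M → ℝ) :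
    Function.support (fluxDiv ψ N v lam ρ) ⊆ tsupport ρ := by
  intro p hp
  by_contra hρ
  have h0 : ρ =ᶠ[𝓝 p] fun _ => 0 := notMem_tsupport_iff_eventuallyEq.1 hρ
  have h1 : planeDiffReal ρ p = 0 := by
    have := h0.mfderiv_eq (I := 𝓡 2) (I' := 𝓘(ℝ, ℝ))
    rw [planeDiffReal, this, mfderiv_const]
    rfl
  refine hp ?_
  simp [fluxDiv, h1, h0.self_of_nhds]

variable [IsManifold (𝓡 2) ∞ M]

namespace IsOrientedImmersion

/-- Links the intrinsic form to the chart expression; the latter is built from `fderiv` and so is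
visibly `C¹`. -/
theorem fluxCoeff_eq (h : IsOrientedImmersion ψ N) (v : E3) (lam : ℝ) {c : M} {y : E2}
    (hy : y ∈ (chartAt E2 c).target) (w : E2) :
    fluxCoeff ψ N v lam c w y = fluxForm ψ N v lam ((chartAt E2 c).symm y) (frame c y w) := by
  rw [fluxCoeff, (h.hasFDerivAt_pull_immersion hy).fderiv]
  rfl

theorem contDiffOn_fluxCoeff (h : IsOrientedImmersion ψ N) (v : E3) (lam : ℝ) (c : M) (w : E2) :
    ContDiffOn ℝ 1 (fluxCoeff ψ N v lam c w) (chartAt E2 c).target := by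
  have h1 := (h.contDiffOn_fderiv_pull_immersion c).clm_apply (contDiffOn_const (c := w))
  have h2 : ContDiffOn ℝ 1 (pull c fun q => (N q : E3)) (chartAt E2 c).target :=
    contDiffOn_pull (n := 1) c h.contMDiff_gauss
  have h3 : ContDiffOn ℝ 1 (pull c ψ) (chartAt E2 c).target :=
    (contDiffOn_pull (n := 2) c h.contMDiff).of_le (by norm_num)
  have h4 : ContDiff ℝ 1 fun z : E3 × E3 => triple v z.1 z.2 :=
    (triple v).isBoundedBilinearMap.contDiff
  exact (contDiffOn_const.mul (h4.comp_contDiffOn (h2.prodMk h1))).add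
    (contDiffOn_const.mul (h4.comp_contDiffOn (h3.prodMk h1)))

/-- The differential of `fluxForm` in a chart. -/
theorem fderiv_fluxCoeff_sub (h : IsOrientedImmersion ψ N) (v : E3) (lam : ℝ) {c : M} {y : E2}
    (hy : y ∈ (chartAt E2 c).target) :
    fderiv ℝ (fluxCoeff ψ N v lam c (stdVec 1)) y (stdVec 0)
      - fderiv ℝ (fluxCoeff ψ N v lam c (stdVec 0)) y (stdVec 1) =
    (lam - meanCurvature ψ N ((chartAt E2 c).symm y)) *
      ⟪(N ((chartAt E2 c).symm y) : E3), v⟫_ℝ * density ψ N c y := by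
  have hopen := (chartAt E2 c).open_target.mem_nhds hy
  have hΨ := h.hasFDerivAt_pull_immersion hy
  have hN := h.hasFDerivAt_pull_gauss hy
  have hD : HasFDerivAt (fderiv ℝ (pull c ψ)) (fderiv ℝ (fderiv ℝ (pull c ψ)) y) y :=
    (((h.contDiffOn_fderiv_pull_immersion c).contDiffAt hopen).differentiableAt
      (by simp)).hasFDerivAt
  -- The terms containing second derivatives of `ψ` cancel in the antisymmetrization by this
  -- symmetry, leaving `dN ∧ dψ` and `dψ ∧ dψ`.
  have hsymm : fderiv ℝ (fderiv ℝ (pull c ψ)) y (stdVec 0) (stdVec 1) =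
      fderiv ℝ (fderiv ℝ (pull c ψ)) y (stdVec 1) (stdVec 0) :=
    ((((contDiffOn_pull (n := 2) c h.contMDiff).contDiffAt hopen)).isSymmSndFDerivAt
      (by simp)) _ _
  have hderiv : ∀ w u : E2, fderiv ℝ (fluxCoeff ψ N v lam c w) y u =
      (1 / 2) * (triple v (pull c (fun q => (N q : E3)) y)
          (fderiv ℝ (fderiv ℝ (pull c ψ)) y u w)
        + triple v (planeDiff (fun q => (N q : E3)) ((chartAt E2 c).symm y) (frame c y u))
          (planeDiff ψ ((chartAt E2 c).symm y) (frame c y w)))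
      + (lam / 2) * (triple v (pull c ψ y) (fderiv ℝ (fderiv ℝ (pull c ψ)) y u w)
        + triple v (planeDiff ψ ((chartAt E2 c).symm y) (frame c y u))
          (planeDiff ψ ((chartAt E2 c).symm y) (frame c y w))) := by
    intro w u
    have hDw := hD.clm_apply (hasFDerivAt_const w y)
    have e1 := (triple v).hasFDerivAt_of_bilinear hN hDw
    have e2 := (triple v).hasFDerivAt_of_bilinear hΨ hDw
    have e3 := (e1.const_mul (1 / 2)).add (e2.const_mul (lam / 2))
    have e4 : fderiv ℝ (fluxCoeff ψ N v lam c w) y = _ := e3.fderiv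
    rw [e4, hΨ.fderiv]
    simp
    ring
  rw [hderiv, hderiv, hsymm]
  have key := h.triple_shape_planeDiff ((chartAt E2 c).symm y) v (frame c y (stdVec 0))
    (frame c y (stdVec 1))
  have key2 := h.triple_planeDiff ((chartAt E2 c).symm y) v (frame c y (stdVec 0))
    (frame c y (stdVec 1))
  have key3 := triple_swap v (planeDiff ψ ((chartAt E2 c).symm y) (frame c y (stdVec 1)))
    (planeDiff ψ ((chartAt E2 c).symm y) (frame c y (stdVec 0)))
  rw [key3]
  rw [density]
  change _ = _ * triple (N ((chartAt E2 c).symm y) : E3) _ _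
  linear_combination (1 / 2) * key + (lam - meanCurvature ψ N ((chartAt E2 c).symm y)) * key2

/-- The differential of `ρ • fluxForm` in a chart. -/
theorem pull_fluxDiv_mul_density (h : IsOrientedImmersion ψ N) (v : E3) (lam : ℝ) {ρ : M → ℝ}
    (hρ : ContMDiff (𝓡 2) 𝓘(ℝ, ℝ) 1 ρ) {c : M} {y : E2} (hy : y ∈ (chartAt E2 c).target) :
    pull c (fluxDiv ψ N v lam ρ) y * density ψ N c y =
      fderiv ℝ (fun z => pull c ρ z * fluxCoeff ψ N v lam c (stdVec 1) z) y (stdVec 0)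
      - fderiv ℝ (fun z => pull c ρ z * fluxCoeff ψ N v lam c (stdVec 0) z) y (stdVec 1) := by
  have hopen := (chartAt E2 c).open_target.mem_nhds hy
  have hρ' : HasFDerivAt (pull c ρ)
      ((planeDiffReal ρ ((chartAt E2 c).symm y)).comp (frame c y)) y :=
    hasFDerivAt_pull hy ((hρ _).mdifferentiableAt (by simp)).hasMFDerivAt
  have hη : ∀ w, DifferentiableAt ℝ (fluxCoeff ψ N v lam c w) y := fun w =>
    ((h.contDiffOn_fluxCoeff v lam c w).contDiffAt hopen).differentiableAt (by simp)
  rw [fderiv_fun_mul hρ'.differentiableAt (hη _), fderiv_fun_mul hρ'.differentiableAt (hη _),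
    hρ'.fderiv]
  have key := h.fderiv_fluxCoeff_sub v lam hy
  set p := (chartAt E2 c).symm y with hp
  have hJ : triple (N p : E3) (planeDiff ψ p (stdVec 0)) (planeDiff ψ p (stdVec 1)) ≠ 0 :=
    triple_ne_zero (inner_gauss_self N _) (h.inner_planeDiff_gauss _ _)
      (h.inner_planeDiff_gauss _ _) (h.linearIndependent_planeDiff p)
  -- `density` and `dρ ∧ ω` on the frame carry the same determinant, so it cancels from the quotient
  -- in `fluxDiv`.
  have hdens : density ψ N c y =
      (frame c y (stdVec 0) 0 * frame c y (stdVec 1) 1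
        - frame c y (stdVec 0) 1 * frame c y (stdVec 1) 0) *
      triple (N p : E3) (planeDiff ψ p (stdVec 0)) (planeDiff ψ p (stdVec 1)) :=
    triple_map_map _ _ _ _
  have hwedge := wedge_map_map (planeDiffReal ρ p) (fluxForm ψ N v lam p)
    (frame c y (stdVec 0)) (frame c y (stdVec 1))
  have h1 : pull c (fluxDiv ψ N v lam ρ) y * density ψ N c y =
      ρ p * ((lam - meanCurvature ψ N p) * ⟪(N p : E3), v⟫_ℝ * density ψ N c y) +
      (planeDiffReal ρ p (frame c y (stdVec 0)) * fluxForm ψ N v lam p (frame c y (stdVec 1))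
      - planeDiffReal ρ p (frame c y (stdVec 1)) *
        fluxForm ψ N v lam p (frame c y (stdVec 0))) := by
    have h2 : pull c (fluxDiv ψ N v lam ρ) y = fluxDiv ψ N v lam ρ p := rfl
    have h3 := hwedge
    rw [h2, fluxDiv, add_mul, hdens]
    have h4 : ∀ a b J : ℝ, J ≠ 0 → a / J * (b * J) = b * a := fun a b J hJ => by field_simp
    rw [h4 _ _ _ hJ]
    linear_combination -h3
  rw [h1, ← key]
  simp only [add_apply, smul_apply, smul_eq_mul, ContinuousLinearMap.comp_apply]
  rw [h.fluxCoeff_eq v lam hy, h.fluxCoeff_eq v lam hy]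
  simp only [← hp]
  have h5 : pull c ρ y = ρ p := rfl
  rw [h5]
  ring

end IsOrientedImmersion

end Stokes

/-! ### Partition of unity and the global flux formula -/

section Flux

open Set Topology MeasureTheory

variable {M : Type*} [TopologicalSpace M] [ChartedSpace (EuclideanSpace ℝ (Fin 2)) M]
  {ψ : M → E3} {N : M → S2}

theorem isCompact_image_chart {c : M} {C : Set M} (hC : IsCompact C)
    (hCc : C ⊆ (chartAt E2 c).source) : IsCompact (chartAt E2 c '' C) :=
  hC.image_of_continuousOn ((chartAt E2 c).continuousOn.mono hCc)

theorem image_chart_subset {c : M} {C : Set M} (hCc : C ⊆ (chartAt E2 c).source) :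
    chartAt E2 c '' C ⊆ (chartAt E2 c).target := by
  rintro _ ⟨p, hp, rfl⟩
  exact (chartAt E2 c).map_source (hCc hp)

theorem symm_notMem_of_notMem_image {c : M} {C : Set M} {y : E2}
    (hy : y ∈ (chartAt E2 c).target) (hyC : y ∉ chartAt E2 c '' C) :
    (chartAt E2 c).symm y ∉ C :=
  fun h => hyC ⟨_, h, (chartAt E2 c).right_inv hy⟩

theorem planeDiffReal_sum {ι : Type*} [Fintype ι] {ρ : ι → M → ℝ}
    (hρ : ∀ i, ContMDiff (𝓡 2) 𝓘(ℝ, ℝ) 1 (ρ i)) (hsum : ∀ p, ∑ i, ρ i p = 1) (p : M) :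
    ∑ i, planeDiffReal (ρ i) p = 0 := by
  classical
  have hconst : ∀ r : ℝ, planeDiffReal (fun _ : M => r) p = 0 := fun _ => mfderiv_const
  have key : ∀ s : Finset ι,
      planeDiffReal (fun q => ∑ i ∈ s, ρ i q) p = ∑ i ∈ s, planeDiffReal (ρ i) p := by
    intro s
    induction s using Finset.induction_on with
    | empty => simpa only [Finset.sum_empty] using hconst 0
    | insert i s hi ih =>
      simp only [Finset.sum_insert hi, ← ih]
      have hs : ContMDiff (𝓡 2) 𝓘(ℝ, ℝ) 1 fun q => ∑ i ∈ s, ρ i q :=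
        contMDiff_finsetSum fun i _ => hρ i
      exact mfderiv_add ((hρ i p).mdifferentiableAt (by simp))
        ((hs p).mdifferentiableAt (by simp))
  rw [← key]
  simp only [hsum]
  exact hconst 1

/-- The cutoff terms cancel because `∑ dρ i = d 1 = 0`. -/
theorem sum_fluxDiv {ι : Type*} [Fintype ι] {ρ : ι → M → ℝ}
    (hρ : ∀ i, ContMDiff (𝓡 2) 𝓘(ℝ, ℝ) 1 (ρ i)) (hsum : ∀ p, ∑ i, ρ i p = 1) (v : E3) (lam : ℝ)
    (p : M) : ∑ i, fluxDiv ψ N v lam (ρ i) p =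
      (lam - meanCurvature ψ N p) * ⟪(N p : E3), v⟫_ℝ := by
  have h := planeDiffReal_sum hρ hsum p
  have h0 : ∀ a, ∑ i, planeDiffReal (ρ i) p a = 0 := fun a => by
    rw [← sum_apply, h]; rfl
  simp only [fluxDiv]
  rw [Finset.sum_add_distrib, ← Finset.sum_mul, hsum, ← Finset.sum_div, Finset.sum_sub_distrib,
    ← Finset.sum_mul, ← Finset.sum_mul, h0, h0]
  simp

variable [IsManifold (𝓡 2) ∞ M]

namespace IsOrientedImmersion

theorem integrableOn_chart (h : IsOrientedImmersion ψ N) {c : M} {C : Set M} (hC : IsCompact C)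
    (hCc : C ⊆ (chartAt E2 c).source) {g : M → ℝ}
    (hg : ContinuousOn (pull c g) (chartAt E2 c).target) (h0 : ∀ p ∉ C, g p = 0) :
    IntegrableOn (fun y => pull c g y * |density ψ N c y|) (chartAt E2 c).target := by
  refine integrableOn_of_eq_zero_off_compact (chartAt E2 c).open_target
    (isCompact_image_chart hC hCc) (image_chart_subset hCc)
    (hg.mul (h.continuousOn_density c).abs) fun y hy hyC => ?_
  have : pull c g y = 0 := h0 _ (symm_notMem_of_notMem_image hy hyC)
  rw [this, zero_mul]

theorem chartIntegral_sum (h : IsOrientedImmersion ψ N) {ι : Type*} [Fintype ι] {c : M}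
    {C : ι → Set M} (hC : ∀ i, IsCompact (C i)) (hCc : ∀ i, C i ⊆ (chartAt E2 c).source)
    {g : ι → M → ℝ} (hg : ∀ i, ContinuousOn (pull c (g i)) (chartAt E2 c).target)
    (h0 : ∀ i, ∀ p ∉ C i, g i p = 0) :
    chartIntegral ψ N c (fun p => ∑ i, g i p) = ∑ i, chartIntegral ψ N c (g i) := by
  simp only [chartIntegral]
  rw [← integral_finsetSum _ fun i _ => h.integrableOn_chart (hC i) (hCc i) (hg i) (h0 i)]
  refine setIntegral_congr_fun (chartAt E2 c).open_target.measurableSet fun y _ => ?_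
  simp only [pull, Finset.sum_mul]

/-- Continuity is seen by writing the function as the chart differential of `ρ ω` divided by the
nonvanishing `density`. -/
theorem continuousOn_pull_fluxDiv (h : IsOrientedImmersion ψ N) (v : E3) (lam : ℝ) {ρ : M → ℝ}
    (hρ : ContMDiff (𝓡 2) 𝓘(ℝ, ℝ) 1 ρ) (c : M) :
    ContinuousOn (pull c (fluxDiv ψ N v lam ρ)) (chartAt E2 c).target := by
  have hF : ∀ w u, ContinuousOn (fun y => fderiv ℝ
      (fun z => pull c ρ z * fluxCoeff ψ N v lam c w z) y u) (chartAt E2 c).target := fun w u =>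
    (((contDiffOn_pull (n := 1) c hρ).mul (h.contDiffOn_fluxCoeff v lam c w)).continuousOn_fderiv_of_isOpen
      (chartAt E2 c).open_target (by norm_num)).clm_apply continuousOn_const
  refine (((hF (stdVec 1) (stdVec 0)).sub (hF (stdVec 0) (stdVec 1))).div
    (h.continuousOn_density c) fun y hy => h.density_ne_zero hy).congr fun y hy => ?_
  refine (eq_div_iff (h.density_ne_zero hy)).2 ?_
  exact h.pull_fluxDiv_mul_density v lam hρ hy

/-- Stokes' theorem for `ρ • fluxForm`, where `ρ` is supported in a part of the domain of a
chart in which the orientation of the chart does not change. -/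
theorem chartIntegral_fluxDiv_eq_zero [CompactSpace M] (h : IsOrientedImmersion ψ N) (v : E3)
    (lam : ℝ) {ρ : M → ℝ} (hρ : ContMDiff (𝓡 2) 𝓘(ℝ, ℝ) 1 ρ) {c : M}
    (hsupp : tsupport ρ ⊆ (chartAt E2 c).source) {s : ℝ} (hs : s ≠ 0)
    (hsign : ∀ p ∈ tsupport ρ, 0 < s * density ψ N c (chartAt E2 c p)) :
    chartIntegral ψ N c (fluxDiv ψ N v lam ρ) = 0 := by
  set U := (chartAt E2 c).target with hU
  have hUo : IsOpen U := (chartAt E2 c).open_target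
  set K := chartAt E2 c '' tsupport ρ with hK
  have hKc : IsCompact K := isCompact_image_chart (isClosed_tsupport ρ).isCompact hsupp
  have hKU : K ⊆ U := image_chart_subset hsupp
  set F : E2 → E2 → ℝ := fun w z => pull c ρ z * fluxCoeff ψ N v lam c w z with hF
  have hFc : ∀ w, ContDiffOn ℝ 1 (F w) U := fun w =>
    (contDiffOn_pull (n := 1) c hρ).mul (h.contDiffOn_fluxCoeff v lam c w)
  have hF0 : ∀ w, ∀ y ∈ U, y ∉ K → F w y = 0 := by
    intro w y hy hyK
    have : pull c ρ y = 0 :=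
      image_eq_zero_of_notMem_tsupport (f := ρ) (symm_notMem_of_notMem_image hy hyK)
    simp only [hF, this, zero_mul]
  have hint : ∀ w u, IntegrableOn (fun y => fderiv ℝ (F w) y u) U := by
    intro w u
    refine integrableOn_of_eq_zero_off_compact hUo hKc hKU
      (((hFc w).continuousOn_fderiv_of_isOpen hUo (by norm_num)).clm_apply continuousOn_const) ?_
    intro y hy hyK
    have : F w =ᶠ[𝓝 y] fun _ => 0 := Filter.eventuallyEq_of_mem
      ((hUo.sdiff hKc.isClosed).mem_nhds ⟨hy, hyK⟩) fun z hz => hF0 w z hz.1 hz.2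
    rw [this.fderiv_eq]
    simp
  -- The factor `|s| / s` is the sign of `s`, which is the sign of `density` on `K`; off `K` the
  -- function `fluxDiv` vanishes.
  have hpt : ∀ y ∈ U, pull c (fluxDiv ψ N v lam ρ) y * |density ψ N c y| =
      |s| / s * (fderiv ℝ (F (stdVec 1)) y (stdVec 0) - fderiv ℝ (F (stdVec 0)) y (stdVec 1)) := by
    intro y hy
    rw [← h.pull_fluxDiv_mul_density v lam hρ hy]
    by_cases hyK : y ∈ K
    · obtain ⟨p, hp, rfl⟩ := hyK
      have h1 := hsign p hp
      have h2 : |s| * |density ψ N c (chartAt E2 c p)| = s * density ψ N c (chartAt E2 c p) := by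
        rw [← abs_mul, abs_of_pos h1]
      have h3 : |s| * |s| = s * s := abs_mul_abs_self s
      have h4 : |s| ≠ 0 := abs_ne_zero.2 hs
      have h5 : |density ψ N c (chartAt E2 c p)| =
          |s| / s * density ψ N c (chartAt E2 c p) := by
        rw [div_mul_eq_mul_div, eq_div_iff hs]
        apply mul_left_cancel₀ h4
        linear_combination s * h2 - density ψ N c (chartAt E2 c p) * h3
      rw [h5]
      ring
    · have : pull c (fluxDiv ψ N v lam ρ) y = 0 := by
        by_contra h0
        exact symm_notMem_of_notMem_image hy hyK (support_fluxDiv_subset v lam ρ h0)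
      rw [this]
      ring
  rw [chartIntegral, setIntegral_congr_fun hUo.measurableSet hpt, integral_const_mul,
    integral_sub (hint _ _) (hint _ _),
    setIntegral_fderiv_eq_zero hUo hKc hKU (hFc _) (hF0 _),
    setIntegral_fderiv_eq_zero hUo hKc hKU (hFc _) (hF0 _)]
  simp

theorem isOpen_orientedDomain (h : IsOrientedImmersion ψ N) (c : M) (s : ℝ) :
    IsOpen {p | p ∈ (chartAt E2 c).source ∧ 0 < s * density ψ N c (chartAt E2 c p)} := by
  have h1 : ContinuousOn (fun p => s * density ψ N c (chartAt E2 c p)) (chartAt E2 c).source :=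
    continuousOn_const.mul ((h.continuousOn_density c).comp (chartAt E2 c).continuousOn
      (chartAt E2 c).mapsTo)
  exact h1.isOpen_inter_preimage (chartAt E2 c).open_source isOpen_Ioi

/-- A closed surface has a finite partition of unity by functions supported in domains of
charts in which the orientation of the chart does not change. -/
theorem exists_partition [T2Space M] [CompactSpace M] (h : IsOrientedImmersion ψ N) :
    ∃ (t : Finset M) (ρ : t → M → ℝ), (∀ i, ContMDiff (𝓡 2) 𝓘(ℝ, ℝ) 1 (ρ i)) ∧
      (∀ i p, 0 ≤ ρ i p) ∧ (∀ p, ∑ i, ρ i p = 1) ∧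
      (∀ i, tsupport (ρ i) ⊆ (chartAt E2 (i : M)).source) ∧
      (∀ i, ∀ p ∈ tsupport (ρ i), 0 < density ψ N (i : M) (chartAt E2 (i : M) i) *
        density ψ N (i : M) (chartAt E2 (i : M) p)) := by
  -- The reference sign is that of `density` at the centre `c`, so that `c ∈ U c`.
  set U : M → Set M := fun c => {p | p ∈ (chartAt E2 c).source ∧
    0 < density ψ N c (chartAt E2 c c) * density ψ N c (chartAt E2 c p)} with hU
  have hUo : ∀ c, IsOpen (U c) := fun c => h.isOpen_orientedDomain c _
  have hUc : ∀ c, c ∈ U c := fun c => ⟨mem_chart_source _ c,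
    mul_self_pos.2 (h.density_ne_zero (mem_chart_target _ c))⟩
  obtain ⟨t, -, ht⟩ := isCompact_univ.elim_nhds_subcover U fun c _ => (hUo c).mem_nhds (hUc c)
  obtain ⟨f, hf⟩ := SmoothPartitionOfUnity.exists_isSubordinate (𝓡 2) (s := (univ : Set M))
    isClosed_univ (fun i : t => U i) (fun i => hUo i) (by
      intro p hp
      obtain ⟨c, hc, hpc⟩ := mem_iUnion₂.1 (ht hp)
      exact mem_iUnion.2 ⟨⟨c, hc⟩, hpc⟩)
  refine ⟨t, fun i => f i, fun i => (f i).contMDiff.of_le (by simp), fun i p => f.nonneg i p,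
    fun p => ?_, fun i p hp => (hf i hp).1, fun i p hp => (hf i hp).2⟩
  rw [← finsum_eq_sum_of_fintype]
  exact f.sum_eq_one (mem_univ p)

/-- On a closed surface `∫ (H - lam) ⟨N, v⟩ dA = 0`. Hence the integrand vanishes if it is
nonnegative. -/
theorem flux_eq_zero_of_nonneg [T2Space M] [CompactSpace M] (h : IsOrientedImmersion ψ N)
    (v : E3) (lam : ℝ) (hcont : Continuous (meanCurvature ψ N))
    (hnn : ∀ p, 0 ≤ (meanCurvature ψ N p - lam) * ⟪(N p : E3), v⟫_ℝ) (p : M) :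
    (meanCurvature ψ N p - lam) * ⟪(N p : E3), v⟫_ℝ = 0 := by
  obtain ⟨t, ρ, hρ, hρ0, hρ1, hsub, hsign⟩ := h.exists_partition
  set D : t → M → ℝ := fun i => fluxDiv ψ N v lam (ρ i) with hD
  set f : M → ℝ := fun p => (meanCurvature ψ N p - lam) * ⟪(N p : E3), v⟫_ℝ with hf
  have hfc : Continuous f :=
    (hcont.sub continuous_const).mul (h.contMDiff_gauss.continuous.inner continuous_const)
  have hC : ∀ i, IsCompact (tsupport (ρ i)) := fun i => (isClosed_tsupport _).isCompact
  have hDsupp : ∀ i, ∀ p ∉ tsupport (ρ i), D i p = 0 := fun i p hp => by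
    by_contra h0
    exact hp (support_fluxDiv_subset v lam (ρ i) h0)
  have hDc : ∀ i j c, ContinuousOn (pull c fun p => ρ j p * D i p) (chartAt E2 c).target :=
    fun i j c => (continuousOn_pull c (hρ j).continuous).mul
      (h.continuousOn_pull_fluxDiv v lam (hρ i) c)
  -- The terms `ρ j * D i` can be integrated in either chart. Summed over `j` in chart `i` they give
  -- `∫ D i = 0`; summed over `i` in chart `j` they give `-∫ ρ j * f`. Exchanging the sums yields
  -- the flux formula.
  have hswap : ∀ i j : t, chartIntegral ψ N (j : M) (fun p => ρ j p * D i p) =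
      chartIntegral ψ N (i : M) fun p => ρ j p * D i p := by
    intro i j
    refine chartIntegral_eq_of_support ψ N ?_ ?_
    · exact fun p hp => hsub j (subset_tsupport _ (left_ne_zero_of_mul hp))
    · exact fun p hp => hsub i (support_fluxDiv_subset v lam (ρ i) (right_ne_zero_of_mul hp))
  have hrow : ∀ i : t, ∑ j, chartIntegral ψ N (i : M) (fun p => ρ j p * D i p) = 0 := by
    intro i
    rw [← h.chartIntegral_sum (C := fun _ => tsupport (ρ i)) (fun _ => hC i) (fun _ => hsub i)
      (fun j => hDc i j i) fun j p hp => by rw [hDsupp i p hp, mul_zero]]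
    simp only [← Finset.sum_mul, hρ1, one_mul]
    exact h.chartIntegral_fluxDiv_eq_zero v lam (hρ i) (hsub i)
      (h.density_ne_zero (mem_chart_target _ (i : M))) (hsign i)
  have hcol : ∀ j : t, -chartIntegral ψ N (j : M) (fun p => ρ j p * f p) =
      ∑ i, chartIntegral ψ N (j : M) (fun p => ρ j p * D i p) := by
    intro j
    rw [← h.chartIntegral_sum (C := fun _ => tsupport (ρ j)) (fun _ => hC j) (fun _ => hsub j)
      (fun i => hDc i j j) fun i p hp => by rw [image_eq_zero_of_notMem_tsupport hp, zero_mul]]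
    simp only [← Finset.mul_sum, hD, sum_fluxDiv hρ hρ1]
    rw [chartIntegral, chartIntegral, ← integral_neg]
    congr 1
    funext y
    simp only [pull, hf]
    ring
  have htotal : ∑ j : t, chartIntegral ψ N (j : M) (fun p => ρ j p * f p) = 0 := by
    rw [← neg_eq_zero, ← Finset.sum_neg_distrib]
    simp only [hcol]
    rw [Finset.sum_congr rfl fun j _ => Finset.sum_congr rfl fun i _ => hswap i j,
      Finset.sum_comm]
    exact Finset.sum_eq_zero fun i _ => hrow i
  have hgc : ∀ j : t, ContinuousOn (pull (j : M) fun p => ρ j p * f p)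
      (chartAt E2 (j : M)).target := fun j =>
    continuousOn_pull _ ((hρ j).continuous.mul hfc)
  have hgnn : ∀ (j : t) (y : E2),
      0 ≤ pull (j : M) (fun p => ρ j p * f p) y * |density ψ N (j : M) y| := fun j y =>
    mul_nonneg (mul_nonneg (hρ0 j _) (hnn _)) (abs_nonneg _)
  have hzero : ∀ j : t, chartIntegral ψ N (j : M) (fun p => ρ j p * f p) = 0 := fun j =>
    (Finset.sum_eq_zero_iff_of_nonneg fun j _ => integral_nonneg (hgnn j)).1 htotal j
      (Finset.mem_univ j)
  -- Each integral vanishes and its integrand is nonnegative and continuous, so it is zero at every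
  -- point of the chart; `density` can then be divided out.
  have hvanish : ∀ j : t, ρ j p * f p = 0 := by
    intro j
    by_cases hp : p ∈ (chartAt E2 (j : M)).source
    · have h1 := (setIntegral_eq_zero_iff_of_nonneg_ae
        (Filter.Eventually.of_forall (hgnn j)) (h.integrableOn_chart (hC j) (hsub j) (hgc j)
          fun p hp => by rw [image_eq_zero_of_notMem_tsupport hp, zero_mul])).1 (hzero j)
      have h2 := Measure.eqOn_open_of_ae_eq h1 (chartAt E2 (j : M)).open_target
        ((hgc j).mul (h.continuousOn_density _).abs) continuousOn_const
      have hy := (chartAt E2 (j : M)).map_source hp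
      have h3 : pull (j : M) (fun p => ρ j p * f p) (chartAt E2 (j : M) p) *
        |density ψ N (j : M) (chartAt E2 (j : M) p)| = 0 := h2 hy
      have h4 := (mul_eq_zero.1 h3).resolve_right (abs_ne_zero.2 (h.density_ne_zero hy))
      simpa only [pull, (chartAt E2 (j : M)).left_inv hp] using h4
    · rw [image_eq_zero_of_notMem_tsupport fun hm => hp (hsub j hm), zero_mul]
  have : f p = ∑ j, ρ j p * f p := by rw [← Finset.sum_mul, hρ1, one_mul]
  change f p = 0
  rw [this]
  exact Finset.sum_eq_zero fun j _ => hvanish j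

end IsOrientedImmersion

end Flux

/-! ### Touching points -/

section MaximumPrinciple

open Set Topology Filter

/-- A positive second derivative would make `t` a local minimum as well, so `g` would be locally
constant. -/
theorem deriv_deriv_nonpos_of_isLocalMax {g : ℝ → ℝ} {t : ℝ} (hg : IsLocalMax g t)
    (hc : ContinuousAt g t) : deriv (deriv g) t ≤ 0 := by
  by_contra! hpos
  have hmin := isLocalMin_of_deriv_deriv_pos hpos hg.deriv_eq_zero hc
  have h1 : g =ᶠ[𝓝 t] fun _ => g t := by
    filter_upwards [hg, hmin] with s hs hs'
    exact le_antisymm hs hs'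
  have h2 : deriv (deriv g) t = 0 := by
    rw [h1.deriv.deriv_eq]
    simp
  exact hpos.ne' h2

theorem second_fderiv_nonpos_of_isLocalMax {Q : E2 → ℝ} {y a : E2} (hQ : IsLocalMax Q y)
    (hd : ∀ᶠ z in 𝓝 y, DifferentiableAt ℝ Q z) {G' : E2 →L[ℝ] ℝ}
    (hG : HasFDerivAt (fun z => fderiv ℝ Q z a) G' y) : G' a ≤ 0 := by
  have hℓ : ∀ t : ℝ, HasDerivAt (fun s : ℝ => y + s • a) a t := fun t => by
    simpa using ((hasDerivAt_id t).smul_const a).const_add y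
  have hℓ0 : Tendsto (fun s : ℝ => y + s • a) (𝓝 0) (𝓝 y) := by
    simpa using (hℓ 0).continuousAt.tendsto
  have h0 : y + (0 : ℝ) • a = y := by simp
  have hmax : IsLocalMax (fun s : ℝ => Q (y + s • a)) 0 := by
    have := hℓ0.eventually hQ
    filter_upwards [this] with s hs
    simpa using hs
  have hderiv : deriv (fun s : ℝ => Q (y + s • a)) =ᶠ[𝓝 0]
      fun s => fderiv ℝ Q (y + s • a) a := by
    filter_upwards [hℓ0.eventually hd] with s hs
    exact (hs.hasFDerivAt.comp_hasDerivAt s (hℓ s)).deriv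
  have hcont : ContinuousAt (fun s : ℝ => Q (y + s • a)) 0 := by
    refine ContinuousAt.comp (f := fun s : ℝ => y + s • a) ?_ (hℓ 0).continuousAt
    rw [h0]
    exact hd.self_of_nhds.continuousAt
  have h1 := deriv_deriv_nonpos_of_isLocalMax hmax hcont
  rw [hderiv.deriv_eq] at h1
  have h2 : HasDerivAt (fun s : ℝ => fderiv ℝ Q (y + s • a) a) (G' a) 0 := by
    have hG' : HasFDerivAt (fun z => fderiv ℝ Q z a) G' (y + (0 : ℝ) • a) := by rwa [h0]
    exact hG'.comp_hasDerivAt 0 (hℓ 0)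
  rwa [h2.deriv] at h1

/-- In the Gram determinant of `(n, X, Y)` against `(u, e, f)` the column of `u` is zero, so `triple
u e f = 0` for all `e, f`. -/
theorem eq_zero_of_inner_eq_zero {n X Y u : E3} (h : triple n X Y ≠ 0) (hn : ⟪n, u⟫_ℝ = 0)
    (hX : ⟪X, u⟫_ℝ = 0) (hY : ⟪Y, u⟫_ℝ = 0) : u = 0 := by
  have key : ∀ e f : E3, triple u e f = 0 := by
    intro e f
    have := triple_mul_triple n X Y u e f
    rw [hn, hX, hY] at this
    simpa [h] using this
  have h0 := key (EuclideanSpace.single 1 1) (EuclideanSpace.single 2 1)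
  have h1 := key (EuclideanSpace.single 2 1) (EuclideanSpace.single 0 1)
  have h2 := key (EuclideanSpace.single 0 1) (EuclideanSpace.single 1 1)
  ext i
  fin_cases i
  · simpa [triple_apply] using h0
  · simpa [triple_apply] using h1
  · simpa [triple_apply] using h2

variable {M : Type*} [TopologicalSpace M] [ChartedSpace (EuclideanSpace ℝ (Fin 2)) M]
  [IsManifold (𝓡 2) ∞ M] {ψ : M → E3} {N : M → S2}

namespace IsOrientedImmersion

/-- Comparison of a closed surface with the level sets of `κ |x|² / 2 + ⟨x, w⟩` at a point
where this function is maximal on the surface. -/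
theorem exists_touching_point [CompactSpace M] [Nonempty M] (h : IsOrientedImmersion ψ N)
    (κ : ℝ) (w : E3) :
    ∃ (p : M) (c : ℝ), κ • ψ p + w = c • (N p : E3) ∧ c * meanCurvature ψ N p ≤ -κ := by
  have hcont : Continuous fun q => κ / 2 * ⟪ψ q, ψ q⟫_ℝ + ⟪w, ψ q⟫_ℝ := by
    have := h.contMDiff.continuous
    fun_prop
  obtain ⟨p, -, hp⟩ := isCompact_univ.exists_isMaxOn univ_nonempty hcont.continuousOn
  set y := chartAt E2 p p with hy
  have hyt : y ∈ (chartAt E2 p).target := mem_chart_target _ p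
  have hyp : (chartAt E2 p).symm y = p := (chartAt E2 p).left_inv (mem_chart_source _ p)
  have hnhds := (chartAt E2 p).open_target.mem_nhds hyt
  set Ψ := pull p ψ with hΨdef
  set Q : E2 → ℝ := fun z => κ / 2 * ⟪Ψ z, Ψ z⟫_ℝ + ⟪w, Ψ z⟫_ℝ with hQ
  have hΨy : Ψ y = ψ p := by rw [hΨdef, pull, hyp]
  have hmax : IsLocalMax Q y := Filter.Eventually.of_forall fun z => by
    have := hp (mem_univ ((chartAt E2 p).symm z))
    simp only [hQ, hΨy]
    exact this
  have hQd : ∀ z ∈ (chartAt E2 p).target, HasFDerivAt Q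
      ((innerSL ℝ (κ • Ψ z + w)).comp (fderiv ℝ Ψ z)) z := by
    intro z hz
    have hΨ : HasFDerivAt Ψ (fderiv ℝ Ψ z) z :=
      (h.hasFDerivAt_pull_immersion hz).differentiableAt.hasFDerivAt
    have h1 := ((hΨ.inner ℝ hΨ).const_mul (κ / 2)).add ((hasFDerivAt_const w z).inner ℝ hΨ)
    refine h1.congr_fderiv ?_
    ext b
    simp [real_inner_comm (Ψ z)]
    ring
  have hQe : ∀ a, (fun z => fderiv ℝ Q z a) =ᶠ[𝓝 y]
      fun z => ⟪κ • Ψ z + w, fderiv ℝ Ψ z a⟫_ℝ := fun a => by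
    filter_upwards [hnhds] with z hz
    rw [(hQd z hz).fderiv]
    rfl
  have hΨ : HasFDerivAt Ψ ((planeDiff ψ p).comp (frame p y)) y := by
    have := h.hasFDerivAt_pull_immersion hyt
    rwa [hyp] at this
  have hN : HasFDerivAt (pull p fun q => (N q : E3))
      ((planeDiff (fun q => (N q : E3)) p).comp (frame p y)) y := by
    have := h.hasFDerivAt_pull_gauss hyt
    rwa [hyp] at this
  have hsurj : Function.Surjective (frame p y) :=
    (LinearMap.injective_iff_surjective (f := (frame p y : E2 →ₗ[ℝ] E2))).1 (frame_injective hyt)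
  -- First-order condition at the maximum: `κ ψ + w` is normal to the surface.
  have hcrit : ∀ b, ⟪κ • ψ p + w, planeDiff ψ p b⟫_ℝ = 0 := by
    intro b
    obtain ⟨a, rfl⟩ := hsurj b
    have h1 := (hQe a).self_of_nhds
    simp only [hmax.fderiv_eq_zero, hΨ.fderiv, hΨy] at h1
    exact h1.symm
  set c : ℝ := ⟪(N p : E3), κ • ψ p + w⟫_ℝ with hc
  have hz : κ • ψ p + w = c • (N p : E3) := by
    rw [← sub_eq_zero]
    have hX : ∀ b, ⟪planeDiff ψ p b, κ • ψ p + w - c • (N p : E3)⟫_ℝ = 0 := fun b => by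
      rw [inner_sub_right, inner_smul_right, h.inner_planeDiff_gauss, real_inner_comm, hcrit]
      simp
    refine eq_zero_of_inner_eq_zero (triple_ne_zero (inner_gauss_self N p)
      (h.inner_planeDiff_gauss p (stdVec 0)) (h.inner_planeDiff_gauss p (stdVec 1))
      (h.linearIndependent_planeDiff p)) ?_ (hX _) (hX _)
    rw [inner_sub_right, inner_smul_right, inner_gauss_self, ← hc]
    simp
  refine ⟨p, c, hz, h.meanCurvature_le_of_form_le p fun b => ?_⟩
  obtain ⟨a, rfl⟩ := hsurj b
  have hD : HasFDerivAt (fderiv ℝ Ψ) (fderiv ℝ (fderiv ℝ Ψ) y) y :=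
    (((h.contDiffOn_fderiv_pull_immersion p).contDiffAt hnhds).differentiableAt
      (by simp)).hasFDerivAt
  have hDa := hD.clm_apply (hasFDerivAt_const a y)
  have hG := (((hΨ.const_smul κ).add_const w).inner ℝ hDa).congr_of_eventuallyEq (hQe a)
  have h1 := second_fderiv_nonpos_of_isLocalMax hmax
    (by filter_upwards [hnhds] with z hz using (hQd z hz).differentiableAt) hG
  -- Differentiating `⟨N, dψ a⟩ = 0` expresses `⟨N, d²ψ(a, a)⟩` through `dN`. Since `κ ψ + w = c N`,
  -- this removes `d²ψ` from the second-order condition `h1`.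
  have hNa : (fun z => ⟪pull p (fun q => (N q : E3)) z, fderiv ℝ Ψ z a⟫_ℝ) =ᶠ[𝓝 y]
      fun _ => 0 := by
    filter_upwards [hnhds] with z hz
    rw [(h.hasFDerivAt_pull_immersion hz).fderiv, real_inner_comm]
    exact h.inner_planeDiff_gauss _ _
  have h2 := DFunLike.congr_fun
    (((hN.inner ℝ hDa).congr_of_eventuallyEq hNa.symm).unique (hasFDerivAt_const 0 y)) a
  have hNy : pull p (fun q => (N q : E3)) y = N p := by rw [pull, hyp]
  simp [hΨy, hNy, hz, hΨ.fderiv, inner_smul_left] at h1 h2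
  rw [real_inner_self_eq_norm_sq]
  linear_combination h1 - c * h2

end IsOrientedImmersion

end MaximumPrinciple

/-! ### Zeros of the prescribed function, the Gauss map, and the conclusion -/

section HSurfaces

open Set Topology Filter

/-- Along the great circle `cos t • x + sin t • v` the height over the equator is `sin t`, so `h₀`
is nonpositive just before `x` and nonnegative just after; continuity gives zero at `x`. -/
theorem eq_zero_of_mul_inner_nonneg {h₀ : S2 → ℝ} (hc : Continuous h₀) {v : S2}
    (hv : ∀ x : S2, 0 ≤ h₀ x * ⟪(x : E3), (v : E3)⟫_ℝ) {x : S2}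
    (hx : ⟪(x : E3), (v : E3)⟫_ℝ = 0) : h₀ x = 0 := by
  have hmem : ∀ t : ℝ, Real.cos t • (x : E3) + Real.sin t • (v : E3) ∈ Metric.sphere (0 : E3) 1 := by
    intro t
    rw [mem_sphere_zero_iff_norm, ← sq_eq_sq₀ (norm_nonneg _) zero_le_one,
      ← real_inner_self_eq_norm_sq]
    simp only [inner_add_left, inner_add_right, inner_smul_left, inner_smul_right, conj_trivial,
      real_inner_comm (x : E3) (v : E3), hx, real_inner_self_eq_norm_sq, norm_eq_of_mem_sphere]
    linear_combination Real.cos_sq_add_sin_sq t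
  set γ : ℝ → S2 := fun t => ⟨_, hmem t⟩ with hγ
  have hγc : Continuous γ := by
    refine Continuous.subtype_mk ?_ _
    fun_prop
  have hγ0 : γ 0 = x := by
    apply Subtype.ext
    simp [hγ]
  have hF : Continuous fun t => h₀ (γ t) := hc.comp hγc
  have hsin : ∀ t, 0 ≤ h₀ (γ t) * Real.sin t := by
    intro t
    have := hv (γ t)
    simpa [hγ, inner_add_left, inner_smul_left, hx, real_inner_self_eq_norm_sq] using this
  have hF0 : Tendsto (fun t => h₀ (γ t)) (𝓝 0) (𝓝 (h₀ x)) := by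
    have := hF.tendsto 0
    rwa [hγ0] at this
  apply le_antisymm
  · refine le_of_tendsto (hF0.mono_left (nhdsWithin_le_nhds (s := Iio 0))) ?_
    filter_upwards [Ioo_mem_nhdsLT (neg_lt_zero.2 Real.pi_pos)] with t ht
    exact nonpos_of_mul_nonneg_left (hsin t) (Real.sin_neg_of_neg_of_neg_pi_lt ht.2 ht.1)
  · refine ge_of_tendsto (hF0.mono_left (nhdsWithin_le_nhds (s := Ioi 0))) ?_
    filter_upwards [Ioo_mem_nhdsGT Real.pi_pos] with t ht
    exact nonneg_of_mul_nonneg_left (hsin t) (Real.sin_pos_of_pos_of_lt_pi ht.1 ht.2)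

variable {M : Type*} [TopologicalSpace M] [ChartedSpace (EuclideanSpace ℝ (Fin 2)) M]
  [IsManifold (𝓡 2) ∞ M] {ψ : M → E3} {N : M → S2}

/-- The Gauss map of a closed surface of constant mean curvature is surjective. -/
theorem IsOrientedImmersion.surjective_gauss_of_const [CompactSpace M] [Nonempty M]
    (h : IsOrientedImmersion ψ N) {lam : ℝ} (hH : ∀ p, meanCurvature ψ N p = lam) :
    Function.Surjective N := by
  -- At a point farthest from the origin `c₀ * lam ≤ -1`, which excludes `lam = 0`.
  obtain ⟨_, c₀, -, hc₀⟩ := h.exists_touching_point 1 0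
  rw [hH] at hc₀
  have hlam : lam ≠ 0 := by
    rintro rfl
    norm_num at hc₀
  intro x
  obtain ⟨s, hs1, hsl⟩ : ∃ s : ℝ, s * s = 1 ∧ 0 < s * lam := by
    rcases lt_or_gt_of_ne hlam with hl | hl
    · exact ⟨-1, by norm_num, by linarith⟩
    · exact ⟨1, by norm_num, by linarith⟩
  -- With `κ = 0` the comparison surfaces are planes orthogonal to `x`. Normality leaves `N p = ±
  -- x`; the choice of `s` as the sign of `lam` together with `c * lam ≤ 0` selects `N p = x`.
  obtain ⟨p, c, hp, hc⟩ := h.exists_touching_point 0 (-s • (x : E3))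
  rw [hH, neg_zero] at hc
  rw [zero_smul, zero_add] at hp
  have hcc : c * c = 1 := by
    have := congrArg (fun z : E3 => ⟪z, z⟫_ℝ) hp
    simp only [inner_smul_left, inner_smul_right, conj_trivial, real_inner_self_eq_norm_sq,
      norm_eq_of_mem_sphere] at this
    linarith
  have hcs : c = -s := by
    have h1 : (c - s) * (c + s) = 0 := by linear_combination hcc - hs1
    rcases mul_eq_zero.1 h1 with h2 | h2
    · rw [sub_eq_zero.1 h2] at hc
      exact absurd hc hsl.not_ge
    · linarith
  refine ⟨p, Subtype.ext ?_⟩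
  rw [hcs] at hp
  have hs0 : -s ≠ 0 := by
    intro h0
    rw [neg_eq_zero.1 h0] at hs1
    norm_num at hs1
  exact (smul_right_injective E3 hs0 hp).symm

end HSurfaces

theorem noClosedHSurface_add_const {h₀ : S2 → ℝ} (lam : ℝ) (hc : Continuous h₀)
    (hne : ∃ x, h₀ x ≠ 0)
    (hv : ∃ v : S2, ∀ x : S2, 0 ≤ h₀ x * ⟪(x : E3), (v : E3)⟫_ℝ) :
    NoClosedHSurface.{u} (fun x => h₀ x + lam) := by
  intro M _ _ _ _ _ _ ψ N hM
  obtain ⟨v, hv⟩ := hv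
  have h : IsOrientedImmersion ψ N := hM.toIsOrientedImmersion
  have hH : meanCurvature ψ N = fun p => h₀ (N p) + lam := funext hM.meanCurvature_eq
  have hflux := h.flux_eq_zero_of_nonneg (v : E3) lam
    (by rw [hH]; exact (hc.comp h.continuous_gauss).add continuous_const)
    (fun p => by rw [hH]; simpa using hv (N p))
  have h0 : ∀ p, h₀ (N p) = 0 := by
    intro p
    have := hflux p
    rw [hH] at this
    rcases mul_eq_zero.1 this with h1 | h1
    · simpa using h1
    · exact eq_zero_of_mul_inner_nonneg hc hv h1
  obtain ⟨x, hx⟩ := hne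
  obtain ⟨p, rfl⟩ := h.surjective_gauss_of_const (lam := lam) (fun p => by simp [hH, h0]) x
  exact hx (h0 p)

theorem contMDiff_inner_pow (v : S2) (n : ℕ) :
    ContMDiff (𝓡 2) 𝓘(ℝ, ℝ) 1 fun x : S2 => ⟪(x : E3), (v : E3)⟫_ℝ ^ n := by
  have h1 : ContDiff ℝ 1 fun x : E3 => ⟪x, (v : E3)⟫_ℝ ^ n :=
    (contDiff_id.inner ℝ contDiff_const).pow n
  exact h1.contMDiff.comp contMDiff_coe_sphere

theorem proposition2p5 :
    (∀ (h₀ : S2 → ℝ) (lam : ℝ), ContMDiff (𝓡 2) 𝓘(ℝ, ℝ) 1 h₀ → (∃ x, h₀ x ≠ 0) →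
      (∃ v : S2, ∀ x : S2, 0 ≤ h₀ x * ⟪(x : E3), (v : E3)⟫_ℝ) →
      NoClosedHSurface.{u} (fun x => h₀ x + lam)) ∧
    (∀ (v : S2) (n : ℕ) (lam : ℝ), Odd n → 1 < lam →
      ContMDiff (𝓡 2) 𝓘(ℝ, ℝ) 1 (fun x : S2 => ⟪(x : E3), (v : E3)⟫_ℝ ^ n + lam) ∧
      (∀ x : S2, 0 < ⟪(x : E3), (v : E3)⟫_ℝ ^ n + lam) ∧
      NoClosedHSurface.{u} (fun x => ⟪(x : E3), (v : E3)⟫_ℝ ^ n + lam)) := by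
  refine ⟨fun h₀ lam hc hne hv => noClosedHSurface_add_const lam hc.continuous hne hv,
    fun v n lam hn hlam => ⟨(contMDiff_inner_pow v n).add contMDiff_const, fun x => ?_, ?_⟩⟩
  · have h1 : |⟪(x : E3), (v : E3)⟫_ℝ| ≤ 1 := by
      simpa using abs_real_inner_le_norm (x : E3) (v : E3)
    have h2 : |⟪(x : E3), (v : E3)⟫_ℝ ^ n| ≤ 1 := by
      rw [abs_pow]
      exact pow_le_one₀ (abs_nonneg _) h1
    linarith [(abs_le.1 h2).1]
  · refine noClosedHSurface_add_const lam (contMDiff_inner_pow v n).continuous ⟨v, ?_⟩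
      ⟨v, fun x => ?_⟩
    · rw [inner_gauss_self (fun q : S2 => q) v]
      simp
    -- The product is `⟨x, v⟩ ^ (n + 1)`, an even power.
    · rw [← pow_succ]
      exact hn.add_one.pow_nonneg _
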